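/- Let $N\ge 1$ and let $h_1<h_2$ be real numbers. On $\ell^2(\mathbb Z^N)$ let $(V_y u)(x)=u(x-y)$, let $e_1,\dots,e_N$ be the standard basis of $\mathbb Z^N$, and consider the bounded selfadjoint operator $$H=\sum_{j=1}^N(2I-V_{e_j}-V_{-e_j})+\Phi I,\qquad \Phi(x)=\chi_+(x_N)\Phi_+(x)+\chi_0(x_N)\Phi_0(x)+\chi_-(x_N)\Phi_-(x),$$ where $\chi_+,\chi_0,\chi_-$ are the characteristic functions of $(h_2,\infty)$, $[h_1,h_2]$, $(-\infty,h_1)$, and $\Phi_+,\Phi_0,\Phi_-$ are bounded real-valued functions on $\mathbb Z^N$ which are slowly oscillating at infinity, i.e. $\lim_{x\to\infty}(a(x+y)-a(x))=0$ for every $y\in\mathbb Z^N$. The essential spectrum $sp_{ess}(A)$ of a bounded operator $A$ is the set of all $z\in\mathbb C$ for which $A-zI$ is not Fredholm, and the discrete spectrum $sp_{dis}(A)$ is the set of all eigenvalues of finite multiplicity which are isolated points of the spectrum $sp(A)$. Set $$m(\Phi_\pm)=\liminf_{\mathbb Z^N_\pm\ni x\to\infty}\Phi_\pm(x),\qquad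 M(\Phi_\pm)=\limsup_{\mathbb Z^N_\pm\ni x\to\infty}\Phi_\pm(x),$$ where $\mathbb Z^N_+=\{x\in\mathbb Z^N:x_N>0\}$ and $\mathbb Z^N_-=\mathbb Z^N\setminus\mathbb Z^N_+$. Let $\Lambda$ be the set of all sequences $g=(g',g_N):\mathbb N\to\mathbb Z^{N-1}\times\mathbb Z$ such that $g'\to\infty$, $g_N$ is constant, and the limits $\Phi_\pm^g=\lim_j\Phi_\pm(g(j))$ and $\Phi_0^g=\lim_j\Phi_0(g(j))$ exist. For $g\in\Lambda$ and $t\in\mathbb Z$ put $$\Phi^g(t)=\chi_+(t+g_N)\Phi_+^g+\chi_0(t+g_N)\Phi_0^g+\chi_-(t+g_N)\Phi_-^g,$$ and let $\mathcal L^g=(2I-V_1-V_{-1})+\Phi^g I$ be the corresponding Jacobi operator on $\ell^2(\mathbb Z)$. (1) For every $g\in\Lambda$, the limit operator of $H$ defined by $g$ exists and equals $H_g=\sum_{j=1}^N(2I-V_{e_j}-V_{-e_j})+\Phi^g(x_N)I$; that is, $V_{-g(j)}HV_{g(j)}\to H_g$ and $V_{-g(j)}H^*V_{g(j)}\to H_g^*$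 strongly as $j\to\infty$. Moreover $$sp_{ess}(\mathcal L^g)=[\Phi_+^g,\Phi_+^g+4]\cup[\Phi_-^g,\Phi_-^g+4],$$ the discrete spectrum of $\mathcal L^g$ is a finite set $\{\lambda_1^g,\dots,\lambda_{m(g)}^g\}$ (possibly empty) of real numbers, disjoint from $sp_{ess}(\mathcal L^g)$, and $sp(\mathcal L^g)=sp_{ess}(\mathcal L^g)\cup\{\lambda_1^g,\dots,\lambda_{m(g)}^g\}$. (2) The essential spectrum of $H$ is $$sp_{ess}(H)=[m(\Phi_-),M(\Phi_-)+4N]\cup[m(\Phi_+),M(\Phi_+)+4N]\cup\bigcup_{g\in\Lambda}\bigcup_{j=1}^{m(g)}[\lambda_j^g,\lambda_j^g+4(N-1)].$$ -/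

import Mathlib

open Filter Topology Set
open scoped ENNReal lp

namespace Waveguide

noncomputable section

/-! ### Spectra of bounded operators -/

/-- The essential spectrum: all `z` for which `A - z I` is not Fredholm. -/
def essSpectrum {X : Type*} [NormedAddCommGroup X] [NormedSpace ℂ X] (A : X →L[ℂ] X) : Set ℂ :=
  {z | ¬ (A - z • ContinuousLinearMap.id ℂ X).IsFredholm}

/-- The discrete spectrum: all eigenvalues of finite multiplicity that are isolated points of
the spectrum. (It is used for selfadjoint operators only, for which the geometric and the
algebraic multiplicity of an eigenvalue agree.) -/
def discreteSpectrum {X : Type*} [NormedAddCommGroup X] [NormedSpace ℂ X] (A : X →L[ℂ] X) :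
    Set ℂ :=
  {z | Module.End.HasEigenvalue (A : X →ₗ[ℂ] X) z ∧
    FiniteDimensional ℂ (Module.End.eigenspace (A : X →ₗ[ℂ] X) z) ∧
    ∃ ε > 0, ∀ w ∈ spectrum ℂ A, dist w z < ε → w = z}

/-! ### Operators on `ℓ²(G)` for a discrete abelian group `G` (here `ℤ^N` or `ℤ`) -/

theorem memℓp_shift {G : Type*} [AddCommGroup G] (g : G) (u : ℓ^2(G, ℂ)) :
    Memℓp (fun x => u (x - g)) 2 := by
  have h := (lp.memℓp u).summable (by norm_num)
  exact memℓp_gen ((Equiv.subRight g).summable_iff.mpr h)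

theorem norm_shift {G : Type*} [AddCommGroup G] (g : G) (u : ℓ^2(G, ℂ)) :
    ‖(⟨fun x => u (x - g), memℓp_shift g u⟩ : ℓ^2(G, ℂ))‖ = ‖u‖ := by
  rw [lp.norm_eq_tsum_rpow (by norm_num), lp.norm_eq_tsum_rpow (by norm_num)]
  congr 1
  exact (Equiv.subRight g).tsum_eq (fun x => ‖u x‖ ^ (2 : ℝ≥0∞).toReal)

/-- The shift `V_g` on `ℓ²(G)`, `(V_g u)(x) = u(x - g)`. -/
def shift {G : Type*} [AddCommGroup G] (g : G) : ℓ^2(G, ℂ) →L[ℂ] ℓ^2(G, ℂ) :=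
  LinearMap.mkContinuous
    { toFun := fun u => ⟨fun x => u (x - g), memℓp_shift g u⟩
      map_add' := fun _ _ => rfl
      map_smul' := fun _ _ => rfl } 1
    (fun u => by rw [one_mul]; exact (norm_shift g u).le)

/-- The operator `a I` of multiplication by a bounded real function `a` on `ℓ²(G)`. -/
def mulOp {G : Type*} (a : ℓ^∞(G, ℝ)) : ℓ^2(G, ℂ) →L[ℂ] ℓ^2(G, ℂ) :=
  lp.mapCLM 2 (fun x => (a x : ℂ) • ContinuousLinearMap.id ℂ ℂ) (norm_nonneg a) (fun x => by
    rw [norm_smul, ContinuousLinearMap.norm_id, mul_one, Complex.norm_real]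
    exact lp.norm_apply_le_norm (by simp) a x)

/-- `A'` is the limit operator of `A` defined by the sequence `h` tending to infinity:
`V_{-h(j)} A V_{h(j)} → A'` and `V_{-h(j)} A* V_{h(j)} → A'*` strongly. -/
def IsLimitOperator {G : Type*} [AddCommGroup G] (A : ℓ^2(G, ℂ) →L[ℂ] ℓ^2(G, ℂ)) (h : ℕ → G)
    (A' : ℓ^2(G, ℂ) →L[ℂ] ℓ^2(G, ℂ)) : Prop :=
  Tendsto h atTop cofinite ∧
  (∀ u, Tendsto (fun j => shift (-h j) (A (shift (h j) u))) atTop (𝓝 (A' u))) ∧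
  (∀ u, Tendsto (fun j => shift (-h j) (ContinuousLinearMap.adjoint A (shift (h j) u))) atTop
    (𝓝 (ContinuousLinearMap.adjoint A' u)))

/-- The discrete Schrödinger operator `∑_j (2 I - V_{e_j} - V_{-e_j}) + Φ I` on `ℓ²(ℤ^N)`. -/
def schrodinger {N : ℕ} (Φ : ℓ^∞(Fin N → ℤ, ℝ)) :
    ℓ^2(Fin N → ℤ, ℂ) →L[ℂ] ℓ^2(Fin N → ℤ, ℂ) :=
  ∑ j : Fin N, ((2 : ℂ) • ContinuousLinearMap.id ℂ _ - shift (Pi.single j 1)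
    - shift (-Pi.single j 1)) + mulOp Φ

/-- The Jacobi operator `(2 I - V_1 - V_{-1}) + φ I` on `ℓ²(ℤ)`. -/
def jacobi (φ : ℓ^∞(ℤ, ℝ)) : ℓ^2(ℤ, ℂ) →L[ℂ] ℓ^2(ℤ, ℂ) :=
  ((2 : ℂ) • ContinuousLinearMap.id ℂ _ - shift 1 - shift (-1)) + mulOp φ

/-! ### Potentials -/

/-- A bounded function `a` is slowly oscillating at infinity if `a(x + y) - a(x) → 0` as
`x → ∞`, for every `y`. -/
def SlowlyOscillating {G : Type*} [AddCommGroup G] (a : ℓ^∞(G, ℝ)) : Prop :=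
  ∀ y : G, Tendsto (fun x => a (x + y) - a x) cofinite (𝓝 0)

theorem memℓp_layered {G : Type*} (h₁ h₂ : ℝ) (π : G → ℤ) (am a0 ap : ℓ^∞(G, ℝ)) :
    Memℓp (fun x => (Ioi h₂).indicator 1 (π x : ℝ) * ap x
      + (Icc h₁ h₂).indicator 1 (π x : ℝ) * a0 x
      + (Iio h₁).indicator 1 (π x : ℝ) * am x) ∞ := by
  have key : ∀ (s : Set ℝ) (a : ℓ^∞(G, ℝ)) (x : G),
      ‖s.indicator (1 : ℝ → ℝ) (π x : ℝ) * a x‖ ≤ ‖a‖ := by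
    intro s a x
    have h := lp.norm_apply_le_norm (by simp) a x
    by_cases hx : (π x : ℝ) ∈ s
    · simpa [hx] using h
    · simp [hx]
  refine memℓp_infty ⟨‖ap‖ + ‖a0‖ + ‖am‖, ?_⟩
  rintro _ ⟨x, rfl⟩
  refine (norm_add_le _ _).trans (add_le_add ((norm_add_le _ _).trans (add_le_add ?_ ?_)) ?_)
  · exact key _ ap x
  · exact key _ a0 x
  · exact key _ am x

/-- The layered function `χ₊(π x) ap(x) + χ₀(π x) a0(x) + χ₋(π x) am(x)`, where `χ₊, χ₀, χ₋` are
the characteristic functions of `(h₂, ∞)`, `[h₁, h₂]` and `(-∞, h₁)`. -/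
def layered {G : Type*} (h₁ h₂ : ℝ) (π : G → ℤ) (am a0 ap : ℓ^∞(G, ℝ)) : ℓ^∞(G, ℝ) :=
  ⟨fun x => (Ioi h₂).indicator 1 (π x : ℝ) * ap x
      + (Icc h₁ h₂).indicator 1 (π x : ℝ) * a0 x
      + (Iio h₁).indicator 1 (π x : ℝ) * am x, memℓp_layered h₁ h₂ π am a0 ap⟩

/-- The layered function with the constant values `cm, c0, cp` in the three layers. -/
def layeredConst (G : Type*) (h₁ h₂ : ℝ) (π : G → ℤ) (cm c0 cp : ℝ) : ℓ^∞(G, ℝ) :=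
  layered h₁ h₂ π (cm • 1) (c0 • 1) (cp • 1)

/-- The filter of `x → ∞` within the half space `ℤ₊^N = {x : x_N > 0}`, `N = n + 1`. -/
def upper (n : ℕ) : Filter (Fin (n + 1) → ℤ) := cofinite ⊓ 𝓟 {x | 0 < x (Fin.last n)}

/-- The filter of `x → ∞` within the half space `ℤ₋^N = {x : x_N ≤ 0}`, `N = n + 1`. -/
def lower (n : ℕ) : Filter (Fin (n + 1) → ℤ) := cofinite ⊓ 𝓟 {x | x (Fin.last n) ≤ 0}

/-- The waveguide operator `H = ∑_j (2 I - V_{e_j} - V_{-e_j}) + Φ I` on `ℓ²(ℤ^N)`, `N = n + 1`,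
where (writing `m`, `0`, `p` for the lower, middle and upper layer)
`Φ(x) = χ₊(x_N) Φp(x) + χ₀(x_N) Φ0(x) + χ₋(x_N) Φm(x)`. -/
def hamiltonian {n : ℕ} (h₁ h₂ : ℝ) (Φm Φ0 Φp : ℓ^∞(Fin (n + 1) → ℤ, ℝ)) :
    ℓ^2(Fin (n + 1) → ℤ, ℂ) →L[ℂ] ℓ^2(Fin (n + 1) → ℤ, ℂ) :=
  schrodinger (layered h₁ h₂ (fun x => x (Fin.last n)) Φm Φ0 Φp)

/-- The index set `Λ`: sequences `g = (g', g_N)` in `ℤ^(N-1) × ℤ`, `N = n + 1`, such that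
`g' → ∞`, `g_N` is constant, and the limits of `Φm, Φ0, Φp` along `g` exist. -/
structure Lam {n : ℕ} (Φm Φ0 Φp : ℓ^∞(Fin (n + 1) → ℤ, ℝ)) where
  /-- the sequence `g` -/
  seq : ℕ → Fin (n + 1) → ℤ
  /-- the constant value of `g_N` -/
  height : ℤ
  tendsto_init : Tendsto (fun j => fun i : Fin n => seq j i.castSucc) atTop cofinite
  seq_last : ∀ j, seq j (Fin.last n) = height
  /-- the limit `Φm^g` -/
  cm : ℝ
  /-- the limit `Φ0^g` -/
  c0 : ℝ
  /-- the limit `Φp^g` -/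
  cp : ℝ
  tendsto_neg : Tendsto (fun j => Φm (seq j)) atTop (𝓝 cm)
  tendsto_zero : Tendsto (fun j => Φ0 (seq j)) atTop (𝓝 c0)
  tendsto_pos : Tendsto (fun j => Φp (seq j)) atTop (𝓝 cp)

/-- The operator `H_g = ∑_j (2 I - V_{e_j} - V_{-e_j}) + Φ^g(x_N) I` on `ℓ²(ℤ^N)`, with
`Φ^g(t) = χ₊(t + g_N) Φp^g + χ₀(t + g_N) Φ0^g + χ₋(t + g_N) Φm^g`. -/
def Lam.hamiltonian {n : ℕ} {Φm Φ0 Φp : ℓ^∞(Fin (n + 1) → ℤ, ℝ)} (h₁ h₂ : ℝ)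
    (g : Lam Φm Φ0 Φp) : ℓ^2(Fin (n + 1) → ℤ, ℂ) →L[ℂ] ℓ^2(Fin (n + 1) → ℤ, ℂ) :=
  schrodinger (layeredConst _ h₁ h₂ (fun x => x (Fin.last n) + g.height) g.cm g.c0 g.cp)

/-- The Jacobi operator `L^g = (2 I - V_1 - V_{-1}) + Φ^g I` on `ℓ²(ℤ)`, with
`Φ^g(t) = χ₊(t + g_N) Φp^g + χ₀(t + g_N) Φ0^g + χ₋(t + g_N) Φm^g`. -/
def Lam.jacobi {n : ℕ} {Φm Φ0 Φp : ℓ^∞(Fin (n + 1) → ℤ, ℝ)} (h₁ h₂ : ℝ)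
    (g : Lam Φm Φ0 Φp) : ℓ^2(ℤ, ℂ) →L[ℂ] ℓ^2(ℤ, ℂ) :=
  Waveguide.jacobi (layeredConst ℤ h₁ h₂ (fun t => t + g.height) g.cm g.c0 g.cp)

end

end Waveguide

/-! Membership in the essential spectrum of `H` is tested on shifted vectors. If `V_{-h(k)} H
V_{h(k)}` tends strongly to `H'` and `u` is an approximate eigenvector of `H'` at `z`, then the
vectors `V_{h(k)} u` have constant norm, tend weakly to zero and are asymptotically approximate
eigenvectors of `H`. A Fredholm operator is bounded below along such sequences, so `z` is in the
essential spectrum (`mem_essSpectrum_of_isLimitOperator`). Sequences running away from the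
hyperplane `x_N = 0` produce the Laplacian plus any constant `c` between liminf and limsup, by a
discrete intermediate value argument (`SlowlyOscillating.exists_abs_sub_lt`). Horizontal sequences
produce `H_g`, whose approximate eigenvectors are plane waves in `x'` times eigenfunctions of `L^g`.

Conversely, if the selfadjoint operator `H - z` is not Fredholm, it has approximate eigenvectors
vanishing on any prescribed finite set. Averaging over translates of a large cube cuts them down to
supports of a fixed shape (`exists_localized_approx_eigenvector`). Far out, such a support sees an
almost constant potential, or it lies near the hyperplane and sees an almost exactly layered one
(`trichotomy_of_mem_essSpectrum`). In the second case compactness of the potential values gives some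
`g`. As `H_g` is a Jacobi operator in `x_N` plus a Laplacian in `n = N - 1` variables, `H_g - z` is
bounded below unless the spectrum of `L^g` meets `[z - 4n, z]`
(`exists_le_norm_schr_of_spectrum_jacobi`). Bands of `L^g` are then absorbed by the two outer
intervals, and its eigenvalues give the remaining ones. -/

namespace Waveguide

noncomputable section

/-! ### Selfadjoint and Fredholm operators on a Hilbert space. -/

section Abstract

variable {X : Type*} [NormedAddCommGroup X] [InnerProductSpace ℂ X] [CompleteSpace X]

/-- A selfadjoint operator which is bounded below on the kernel of a finite rank operator is
Fredholm. -/
theorem isFredholm_of_le_norm {Y : Type*} [NormedAddCommGroup Y] [NormedSpace ℂ Y]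
    [FiniteDimensional ℂ Y] {T : X →L[ℂ] X} (hT : IsSelfAdjoint T) (ρ : X →L[ℂ] Y)
    {c : ℝ} (hc : 0 < c) (h : ∀ u, ρ u = 0 → c * ‖u‖ ≤ ‖T u‖) : T.IsFredholm := by
  have hcl : IsClosed (ρ.ker : Set X) := ρ.isClosed_ker
  have hcof : ρ.ker.CoFG := Submodule.CoFG.ker ρ.toLinearMap
  have hanti : AntilipschitzWith (Real.toNNReal c⁻¹) (T.domRestrict ρ.ker) := by
    refine ContinuousLinearMap.antilipschitz_of_bound _ fun u => ?_
    rw [Real.coe_toNNReal _ (inv_nonneg.2 hc.le), inv_mul_eq_div, le_div_iff₀ hc, mul_comm]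
    exact h u.1 u.2
  have hemb : IsClosedEmbedding (T.domRestrict ρ.ker) := by
    have : CompleteSpace ρ.ker := hcl.completeSpace_coe
    exact hanti.isClosedEmbedding (T.domRestrict ρ.ker).uniformContinuous
  -- The restriction of `T` to the closed, finite codimensional kernel of `ρ` is a closed embedding;
  -- strictness and closed range carry over from there to `T`.
  have hs : Topology.IsStrictMap T ∧ IsClosed (T.range : Set X) := by
    rw [T.isStrictMap_isClosed_range_iff_restrict _ hcl]
    exact ⟨hemb.isEmbedding.isStrictMap, by
      rw [LinearMap.coe_range]; exact hemb.isClosed_range⟩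
  have hdisj : Disjoint T.ker ρ.ker := by
    rw [Submodule.disjoint_def]
    intro u hu hu'
    have h1 := h u hu'
    rw [show T u = 0 from hu, norm_zero] at h1
    have : ‖u‖ ≤ 0 := by nlinarith [norm_nonneg u]
    simpa using this
  have hfin : T.ker.FG := Submodule.CoFG.fg_of_disjoint hdisj hcof
  have hfd : FiniteDimensional ℂ T.ker := Submodule.fg_iff_finiteDimensional _ |>.1 hfin
  have horth : T.rangeᗮ = T.ker := by
    have := ContinuousLinearMap.orthogonal_range T
    rwa [(ContinuousLinearMap.isSelfAdjoint_iff'.1 hT)] at this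
  have hcompl : IsCompl T.range T.ker := by
    have : CompleteSpace T.range := hs.2.completeSpace_coe
    rw [← horth]
    exact Submodule.isCompl_orthogonal _
  exact ⟨hs.1, hs.2, hfd, hfin.cofg_of_isCompl hcompl.symm,
    .of_finiteDimensional _⟩

/-- A Fredholm operator is bounded below on the orthogonal complement of its kernel. -/
theorem exists_le_norm_of_isFredholm {T : X →L[ℂ] X} (hT : T.IsFredholm) :
    ∃ c > 0, ∀ u ∈ (T.ker)ᗮ, c * ‖u‖ ≤ ‖T u‖ := by
  have := hT.finite_ker
  have hcompl : Submodule.IsTopCompl T.ker T.kerᗮ := by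
    exact Submodule.isTopCompl_orthogonal _
  obtain ⟨R, hR⟩ := hT.closedComplemented_range.exists_isTopCompl
  let P := hT.fredholmPackage hcompl hR
  have hQ : ∀ u ∈ T.kerᗮ, P.quasiInverse (T u) = u := fun u hu => by
    have h1 : T u = P.decCodom.X₁.subtypeL (P.equiv (P.decDom.proj u)) :=
      congrArg (fun S : X →L[ℂ] X => S u) P.eq_equiv
    have h2 : P.decDom.proj u = ⟨u, hu⟩ := by
      exact Submodule.projectionOnto_apply_left P.decDom.isTopCompl.isCompl ⟨u, hu⟩
    rw [h1, h2]
    simp [ContinuousLinearMap.FredholmPackage.quasiInverse]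
  -- The summand 1 keeps the constant positive even when the quasi-inverse is zero.
  refine ⟨(‖P.quasiInverse‖ + 1)⁻¹, by positivity, fun u hu => ?_⟩
  rw [inv_mul_le_iff₀ (by positivity)]
  calc ‖u‖ = ‖P.quasiInverse (T u)‖ := by rw [hQ u hu]
    _ ≤ ‖P.quasiInverse‖ * ‖T u‖ := P.quasiInverse.le_opNorm _
    _ ≤ _ := by gcongr; linarith

omit [CompleteSpace X] in
theorem isFredholm_of_isUnit {T : X →L[ℂ] X} (hT : IsUnit T) : T.IsFredholm := by
  obtain ⟨u, rfl⟩ := hT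
  let e := ContinuousLinearEquiv.unitsEquiv ℂ X u
  exact ContinuousLinearMap.IsFredholm.of_isQuasiInverse (u := (e : X →L[ℂ] X))
    (v := (e.symm : X →L[ℂ] X)) e.isQuasiInverse

omit [CompleteSpace X] in
theorem essSpectrum_subset_spectrum (A : X →L[ℂ] X) : essSpectrum A ⊆ spectrum ℂ A := by
  intro z hz hz'
  refine hz (isFredholm_of_isUnit ?_)
  have := hz'.neg
  rw [neg_sub] at this
  exact this

theorem discreteSpectrum_subset_spectrum (A : X →L[ℂ] X) :
    discreteSpectrum A ⊆ spectrum ℂ A := by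
  intro z hz hz'
  obtain ⟨u, hu⟩ := hz.1.exists_hasEigenvector
  obtain ⟨v, hv⟩ := ContinuousLinearMap.isUnit_iff_bijective.1 hz'
  refine hu.2 (ContinuousLinearMap.isUnit_iff_bijective.1 hz' |>.1 ?_)
  have := hu.apply_eq_smul
  simp at this
  simp [Algebra.algebraMap_eq_smul_one, this]

/-- A Fredholm operator is bounded below along weakly null sequences. -/
theorem exists_le_norm_of_weaklyNull {T : X →L[ℂ] X} (hT : T.IsFredholm) :
    ∃ c > 0, ∀ (u : ℕ → X) (a b : ℝ), (∀ v, Tendsto (fun k => inner ℂ v (u k)) atTop (𝓝 0)) →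
      (∀ k, ‖u k‖ = a) → Tendsto (fun k => ‖T (u k)‖) atTop (𝓝 b) → c * a ≤ b := by
  obtain ⟨c, hc, h⟩ := exists_le_norm_of_isFredholm hT
  have := hT.finite_ker
  refine ⟨c, hc, fun u a b hu ha hb => ?_⟩
  have hP : Tendsto (fun k => T.ker.starProjection (u k)) atTop (𝓝 0) := by
    simp_rw [(stdOrthonormalBasis ℂ T.ker).starProjection_eq_sum_rankOne]
    simp only [sum_apply, InnerProductSpace.rankOne_apply]
    rw [← Finset.sum_const_zero (ι := Fin (Module.finrank ℂ T.ker)) (s := Finset.univ)]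
    refine tendsto_finsetSum _ fun i _ => ?_
    simpa using (hu ((stdOrthonormalBasis ℂ T.ker i : T.ker) : X)).smul_const
      ((stdOrthonormalBasis ℂ T.ker i : T.ker) : X)
  have h1 : ∀ k, c * (a - ‖T.ker.starProjection (u k)‖) ≤ ‖T (u k)‖ := fun k => by
    have hm := h _ (T.ker.sub_starProjection_mem_orthogonal (u k))
    have hk : T (T.ker.starProjection (u k)) = 0 := T.ker.starProjection_apply_mem (u k)
    rw [map_sub, hk, sub_zero] at hm
    refine le_trans (mul_le_mul_of_nonneg_left ?_ hc.le) hm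
    rw [← ha k]
    exact norm_sub_norm_le _ _
  have h2 : Tendsto (fun k => c * (a - ‖T.ker.starProjection (u k)‖)) atTop (𝓝 (c * (a - 0))) := by
    have := hP.norm
    rw [norm_zero] at this
    exact (tendsto_const_nhds.sub this).const_mul c
  simpa using le_of_tendsto_of_tendsto' h2 hb h1

theorem isSelfAdjoint_sub_real_smul_id {A : X →L[ℂ] X} (hA : IsSelfAdjoint A) (z : ℝ) :
    IsSelfAdjoint (A - (z : ℂ) • ContinuousLinearMap.id ℂ X) :=
  hA.sub (.smul (Complex.conj_ofReal z) (.one _))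

/-- A lower bound gives injectivity and closed range; for a selfadjoint operator the orthogonal
complement of the range is the kernel, so surjectivity follows. -/
theorem notMem_spectrum_of_le_norm {A : X →L[ℂ] X} (hA : IsSelfAdjoint A) (z : ℝ) {c : ℝ}
    (hc : 0 < c) (h : ∀ u, c * ‖u‖ ≤ ‖(A - (z : ℂ) • ContinuousLinearMap.id ℂ X) u‖) :
    (z : ℂ) ∉ spectrum ℂ A := by
  set T := A - (z : ℂ) • ContinuousLinearMap.id ℂ X with hTdef
  have hT : IsSelfAdjoint T := isSelfAdjoint_sub_real_smul_id hA z
  have hF := isFredholm_of_le_norm (Y := Unit → ℂ) hT 0 hc fun u _ => h u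
  have hinj : ∀ u, T u = 0 → u = 0 := fun u hu => by
    have := h u
    rw [hu, norm_zero] at this
    exact norm_le_zero_iff.1 (by nlinarith [norm_nonneg u])
  have hunit : IsUnit T := by
    rw [ContinuousLinearMap.isUnit_iff_bijective]
    refine ⟨(injective_iff_map_eq_zero T).2 hinj, ?_⟩
    have : CompleteSpace T.range := hF.isClosed_range.completeSpace_coe
    have h1 : T.range = ⊤ := by
      rw [← Submodule.orthogonal_eq_bot_iff, ContinuousLinearMap.orthogonal_range,
        ContinuousLinearMap.isSelfAdjoint_iff'.1 hT]
      exact (LinearMap.ker_eq_bot'.2 hinj)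
    exact LinearMap.range_eq_top.1 h1
  refine fun hz => hz ?_
  have := hunit.neg
  rwa [hTdef, neg_sub] at this

/-- Compactness of the spectrum upgrades the strict inequality to a uniform `r' > r`, and the
functional calculus turns `(x - μ)² ≥ r'²` on the spectrum into `(A - μ)² ≥ r'²`. The strict gap
leaves room for a later perturbation of norm at most `r`. -/
theorem exists_lt_le_norm {A : X →L[ℂ] X} (hA : IsSelfAdjoint A) {μ r : ℝ} (hr : 0 ≤ r)
    (h : ∀ x : ℝ, (x : ℂ) ∈ spectrum ℂ A → r < |x - μ|) :
    ∃ r' > r, ∀ u, r' * ‖u‖ ≤ ‖(A - (μ : ℂ) • ContinuousLinearMap.id ℂ X) u‖ := by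
  obtain ⟨r', hr', hs⟩ : ∃ r' > r, ∀ x ∈ spectrum ℝ A, r' ≤ |x - μ| := by
    rcases (spectrum ℝ A).eq_empty_or_nonempty with h0 | h0
    · exact ⟨r + 1, by linarith, by simp [h0]⟩
    · obtain ⟨x, hx, hmin⟩ := (ContinuousFunctionalCalculus.isCompact_spectrum (R := ℝ) A
        ).exists_isMinOn h0 (f := fun x => |x - μ|) (by fun_prop)
      refine ⟨|x - μ|, h x ?_, fun y hy => hmin hy⟩
      exact (spectrum.algebraMap_mem_iff ℂ).2 hx
  refine ⟨r', hr', fun u => ?_⟩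
  set T := A - (μ : ℂ) • ContinuousLinearMap.id ℂ X with hTdef
  have hT : IsSelfAdjoint T := isSelfAdjoint_sub_real_smul_id hA μ
  have h1 : cfc (fun x : ℝ => (x - μ) ^ 2 - r' ^ 2) A = T ^ 2 - (r' ^ 2 : ℝ) • 1 := by
    rw [cfc_sub _ _ A, cfc_pow _ _ A, cfc_sub _ _ A, cfc_id' ℝ A, cfc_const _ A, cfc_const _ A]
    simp only [Algebra.algebraMap_eq_smul_one]
    rfl
  have h2 : 0 ≤ T ^ 2 - (r' ^ 2 : ℝ) • (1 : X →L[ℂ] X) := by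
    rw [← h1]
    refine cfc_nonneg fun x hx => ?_
    have := hs x hx
    rw [sub_nonneg, ← sq_abs (x - μ)]
    gcongr
    linarith
  have h3 := ((ContinuousLinearMap.nonneg_iff_isPositive _).1 h2).re_inner_nonneg_left u
  have h4 : inner ℂ ((T ^ 2 - (r' ^ 2 : ℝ) • (1 : X →L[ℂ] X)) u) u
      = ((‖T u‖ ^ 2 - r' ^ 2 * ‖u‖ ^ 2 : ℝ) : ℂ) := by
    have hs2 : inner ℂ (T (T u)) u = inner ℂ (T u) (T u) := by
      rw [← ContinuousLinearMap.adjoint_inner_right,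
        ContinuousLinearMap.isSelfAdjoint_iff'.1 hT]
    have h5 : (T ^ 2 - (r' ^ 2 : ℝ) • (1 : X →L[ℂ] X)) u = T (T u) - ((r' ^ 2 : ℝ) : ℂ) • u := by
      rw [Complex.coe_smul, pow_two]; rfl
    rw [h5, inner_sub_left, hs2, inner_smul_left, inner_self_eq_norm_sq_to_K,
      inner_self_eq_norm_sq_to_K]
    simp
  rw [h4] at h3
  have h5 : (0 : ℝ) ≤ ‖T u‖ ^ 2 - r' ^ 2 * ‖u‖ ^ 2 := h3
  rw [← mul_pow, sub_nonneg] at h5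
  exact le_of_sq_le_sq h5 (norm_nonneg _)

theorem spectrum_eq_ofReal_re {A : X →L[ℂ] X} (hA : IsSelfAdjoint A) {z : ℂ}
    (hz : z ∈ spectrum ℂ A) : z = (z.re : ℂ) := by
  simpa using hA.mem_spectrum_eq_re hz

theorem hasEigenvalue_eq_ofReal_re {A : X →L[ℂ] X} (hA : IsSelfAdjoint A) {z : ℂ}
    (hz : Module.End.HasEigenvalue (A : X →ₗ[ℂ] X) z) : z = (z.re : ℂ) := by
  have h := (ContinuousLinearMap.isSelfAdjoint_iff_isSymmetric.1 hA).conj_eigenvalue_eq_self hz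
  exact (Complex.conj_eq_iff_re.1 h).symm

/-- A spectral point of a selfadjoint operator outside of the essential spectrum belongs to the
discrete spectrum. -/
theorem mem_discreteSpectrum_of_isFredholm {A : X →L[ℂ] X} (hA : IsSelfAdjoint A) {z : ℂ}
    (hz : z ∈ spectrum ℂ A) (hF : (A - z • ContinuousLinearMap.id ℂ X).IsFredholm) :
    z ∈ discreteSpectrum A := by
  obtain ⟨x, rfl⟩ : ∃ x : ℝ, z = x := ⟨z.re, spectrum_eq_ofReal_re hA hz⟩
  set T := A - (x : ℂ) • ContinuousLinearMap.id ℂ X with hTdef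
  have hT : IsSelfAdjoint T := isSelfAdjoint_sub_real_smul_id hA x
  obtain ⟨c, hc, hb⟩ := exists_le_norm_of_isFredholm hF
  have hfin := hF.finite_ker
  have hker : Module.End.eigenspace (A : X →ₗ[ℂ] X) (x : ℂ) = T.ker := by
    ext u
    rw [Module.End.mem_eigenspace_iff, LinearMap.mem_ker]
    simp [hTdef, sub_eq_zero]
  refine ⟨?_, by rw [hker]; exact hfin, c, hc, fun w hw hwx => ?_⟩
  · rw [Module.End.hasEigenvalue_iff, hker]
    intro h0
    refine notMem_spectrum_of_le_norm hA x hc (fun u => hb u ?_) hz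
    rw [h0, Submodule.bot_orthogonal_eq_top]
    trivial
  · by_contra hne
    obtain ⟨y, rfl⟩ : ∃ y : ℝ, w = y := ⟨w.re, spectrum_eq_ofReal_re hA hw⟩
    rw [dist_eq_norm, ← Complex.ofReal_sub, Complex.norm_real, Real.norm_eq_abs] at hwx
    have hyx : 0 < |y - x| := abs_pos.2 (sub_ne_zero.2 fun h => hne (by rw [h]))
    -- Split `u` along `T.ker` and its complement, both invariant under `A`. On the kernel `A - y`
    -- is the scalar `x - y`; on the complement it is bounded below by `c - |y - x|`.
    refine notMem_spectrum_of_le_norm hA y (c := min |y - x| (c - |y - x|))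
      (lt_min hyx (by linarith)) (fun u => ?_) hw
    set δ := min |y - x| (c - |y - x|)
    have hδ : 0 ≤ δ := (lt_min hyx (by linarith)).le
    set p := T.ker.starProjection u
    set q := u - p with hq
    have hp : p ∈ T.ker := T.ker.starProjection_apply_mem u
    have hqo : q ∈ T.kerᗮ := T.ker.sub_starProjection_mem_orthogonal u
    have hTp : T p = 0 := hp
    have hTq : T q ∈ T.kerᗮ := by
      intro k hk
      have hTk : T k = 0 := hk
      rw [← ContinuousLinearMap.adjoint_inner_left, ContinuousLinearMap.isSelfAdjoint_iff'.1 hT,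
        hTk, inner_zero_left]
    have h1 : (A - (y : ℂ) • ContinuousLinearMap.id ℂ X) u
        = ((x - y : ℝ) : ℂ) • p + (T q + ((x - y : ℝ) : ℂ) • q) := by
      have : u = p + q := by rw [hq]; abel
      rw [this]
      have h2 : T (p + q) = T q := by rw [map_add, hTp, zero_add]
      have h3 : (A - (y : ℂ) • ContinuousLinearMap.id ℂ X) (p + q)
          = T (p + q) + ((x - y : ℝ) : ℂ) • (p + q) := by
        simp [hTdef, sub_smul]; abel
      rw [h3, h2, smul_add]; abel
    have h4 : ‖(A - (y : ℂ) • ContinuousLinearMap.id ℂ X) u‖ ^ 2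
        = ‖((x - y : ℝ) : ℂ) • p‖ ^ 2 + ‖T q + ((x - y : ℝ) : ℂ) • q‖ ^ 2 := by
      rw [h1]
      have := norm_add_sq_eq_norm_sq_add_norm_sq_of_inner_eq_zero (𝕜 := ℂ)
        (((x - y : ℝ) : ℂ) • p) (T q + ((x - y : ℝ) : ℂ) • q)
        ((T.kerᗮ.add_mem hTq (T.kerᗮ.smul_mem _ hqo)) _ (T.ker.smul_mem _ hp))
      simpa [pow_two] using this
    have h5 : ‖u‖ ^ 2 = ‖p‖ ^ 2 + ‖q‖ ^ 2 := by
      have := norm_add_sq_eq_norm_sq_add_norm_sq_of_inner_eq_zero (𝕜 := ℂ) p q (hqo _ hp)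
      have hu : u = p + q := by rw [hq]; abel
      rw [hu]
      simpa [pow_two] using this
    have h6 : δ * ‖p‖ ≤ ‖((x - y : ℝ) : ℂ) • p‖ := by
      rw [norm_smul, Complex.norm_real, Real.norm_eq_abs, abs_sub_comm]
      gcongr
      exact min_le_left _ _
    have h7 : δ * ‖q‖ ≤ ‖T q + ((x - y : ℝ) : ℂ) • q‖ := by
      have h8 := hb q hqo
      have h9 : ‖((x - y : ℝ) : ℂ) • q‖ = |y - x| * ‖q‖ := by
        rw [norm_smul, Complex.norm_real, Real.norm_eq_abs, abs_sub_comm]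
      have h10 := norm_sub_le_norm_add (T q) (((x - y : ℝ) : ℂ) • q)
      have h11 : δ * ‖q‖ ≤ (c - |y - x|) * ‖q‖ := by gcongr; exact min_le_right _ _
      rw [sub_mul] at h11
      linarith
    refine le_of_sq_le_sq ?_ (norm_nonneg _)
    rw [h4, mul_pow, h5, mul_add, ← mul_pow, ← mul_pow]
    gcongr

theorem spectrum_eq_essSpectrum_union {A : X →L[ℂ] X} (hA : IsSelfAdjoint A) :
    spectrum ℂ A = essSpectrum A ∪ discreteSpectrum A := by
  refine Subset.antisymm (fun z hz => ?_)
    (union_subset (essSpectrum_subset_spectrum A) (discreteSpectrum_subset_spectrum A))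
  by_cases h : z ∈ essSpectrum A
  · exact Or.inl h
  · exact Or.inr (mem_discreteSpectrum_of_isFredholm hA hz (not_not.1 h))

/-- If `A - μ` is bounded below by `r` on the kernel of a finite rank operator, then `A` has
finitely many eigenvalues at distance less than `r` from `μ`. -/
theorem finite_eigenvalues_of_le_norm {Y : Type*} [AddCommGroup Y] [Module ℂ Y]
    [FiniteDimensional ℂ Y] {A : X →L[ℂ] X} (hA : IsSelfAdjoint A) (ρ : X →ₗ[ℂ] Y) {μ r : ℝ}
    (h : ∀ u, ρ u = 0 → r * ‖u‖ ≤ ‖(A - (μ : ℂ) • ContinuousLinearMap.id ℂ X) u‖) :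
    {z : ℂ | Module.End.HasEigenvalue (A : X →ₗ[ℂ] X) z ∧ |z.re - μ| < r}.Finite := by
  by_contra hinf
  -- With one eigenvector more than the dimension of `Y`, some nontrivial combination is killed by
  -- `ρ`. Orthogonality of the eigenvectors makes `A - μ` contract it by a factor strictly below
  -- `r`, against the hypothesis.
  obtain ⟨s, hs, hcard⟩ := Set.Infinite.exists_subset_card_eq hinf (Module.finrank ℂ Y + 1)
  have hv : ∀ z : s, ∃ v, Module.End.HasEigenvector (A : X →ₗ[ℂ] X) (z : ℂ) v := fun z =>
    (hs z.2).1.exists_hasEigenvector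
  choose v hv using hv
  have hAv : ∀ z : s, A (v z) = (z : ℂ) • v z := fun z => (hv z).apply_eq_smul
  have horth : Pairwise fun z w : s => inner ℂ (v z) (v w) = 0 := fun z w hzw =>
    (ContinuousLinearMap.isSelfAdjoint_iff_isSymmetric.1 hA).orthogonalFamily_eigenspaces
      (fun h => hzw (Subtype.ext h)) ⟨_, (hv z).1⟩ ⟨_, (hv w).1⟩
  have hdep : ¬ LinearIndependent ℂ fun z : s => ρ (v z) := fun hli => by
    have := hli.fintype_card_le_finrank
    rw [Fintype.card_coe, hcard] at this
    omega
  obtain ⟨a, ha, z₀, hz₀⟩ := Fintype.not_linearIndependent_iff.1 hdep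
  have hnorm : ∀ b : s → ℂ, ‖∑ z, b z • v z‖ ^ 2 = ∑ z, ‖b z‖ ^ 2 * ‖v z‖ ^ 2 := fun b => by
    have h1 : inner ℂ (∑ z, b z • v z) (∑ z, b z • v z)
        = ∑ z, inner ℂ (b z • v z) (b z • v z) := by
      rw [sum_inner]
      refine Finset.sum_congr rfl fun z _ => ?_
      rw [inner_sum]
      refine Finset.sum_eq_single z (fun w _ hw => ?_) (by simp)
      rw [inner_smul_left, inner_smul_right, horth hw.symm, mul_zero, mul_zero]
    simp only [inner_self_eq_norm_sq_to_K, norm_smul, Complex.coe_algebraMap] at h1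
    simp only [← mul_pow]
    exact_mod_cast h1
  set u := ∑ z, a z • v z with hu
  have h1 := h u (by simpa [hu] using ha)
  have h2 : (A - (μ : ℂ) • ContinuousLinearMap.id ℂ X) u = ∑ z : s, (a z * (z - μ)) • v z := by
    rw [hu, map_sum]
    refine Finset.sum_congr rfl fun z _ => ?_
    simp only [sub_apply, map_smul, hAv, smul_apply, ContinuousLinearMap.id_apply, smul_smul,
      ← sub_smul]
  have h3 : ‖(A - (μ : ℂ) • ContinuousLinearMap.id ℂ X) u‖ ^ 2 < r ^ 2 * ‖u‖ ^ 2 := by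
    rw [h2, hnorm, hu, hnorm, Finset.mul_sum]
    have hr : ∀ z : s, ‖(z : ℂ) - μ‖ ^ 2 < r ^ 2 := fun z => by
      have h4 := hasEigenvalue_eq_ofReal_re hA (hs z.2).1
      rw [h4, ← Complex.ofReal_sub, Complex.norm_real, Real.norm_eq_abs]
      exact pow_lt_pow_left₀ (hs z.2).2 (abs_nonneg _) two_ne_zero
    refine Finset.sum_lt_sum (fun z _ => ?_) ⟨z₀, Finset.mem_univ _, ?_⟩
    · rw [norm_mul, mul_pow]
      nlinarith [hr z, mul_nonneg (sq_nonneg ‖a z‖) (sq_nonneg ‖v z‖)]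
    · rw [norm_mul, mul_pow]
      have h5 : 0 < ‖a z₀‖ ^ 2 * ‖v z₀‖ ^ 2 := by
        have := norm_pos_iff.2 hz₀
        have := norm_pos_iff.2 (hv z₀).2
        positivity
      nlinarith [hr z₀]
  have hr0 : 0 ≤ r := (abs_nonneg _).trans (hs z₀.2).2.le
  rw [← mul_pow] at h3
  exact absurd h1 (not_le.2 (lt_of_pow_lt_pow_left₀ 2 (by positivity) h3))

end Abstract

/-! ### Norms, multiplication operators and truncations on `ℓ²`. -/

section Basic

variable {G : Type*}

theorem add_eval (u v : ℓ^2(G, ℂ)) (x : G) : (u + v) x = u x + v x := rfl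

theorem sub_eval (u v : ℓ^2(G, ℂ)) (x : G) : (u - v) x = u x - v x := rfl

theorem smul_eval (c : ℂ) (u : ℓ^2(G, ℂ)) (x : G) : (c • u) x = c * u x := rfl

theorem sum_eval {κ : Type*} (s : Finset κ) (f : κ → ℓ^2(G, ℂ)) (x : G) :
    (∑ j ∈ s, f j) x = ∑ j ∈ s, f j x := by
  rw [lp.coeFn_sum, Finset.sum_apply]

theorem sub_smul_id_apply (A : ℓ^2(G, ℂ) →L[ℂ] ℓ^2(G, ℂ)) (z : ℂ) (u : ℓ^2(G, ℂ)) :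
    (A - z • ContinuousLinearMap.id ℂ ℓ^2(G, ℂ)) u = A u - z • u := rfl

theorem hasSum_norm_sq (u : ℓ^2(G, ℂ)) : HasSum (fun x => ‖u x‖ ^ 2) (‖u‖ ^ 2) := by
  have := lp.hasSum_norm (p := 2) (by norm_num) u
  simpa using this

theorem norm_sq_eq_tsum (u : ℓ^2(G, ℂ)) : ‖u‖ ^ 2 = ∑' x, ‖u x‖ ^ 2 :=
  (hasSum_norm_sq u).tsum_eq.symm

theorem ofReal_norm_sq (u : ℓ^2(G, ℂ)) :
    ENNReal.ofReal (‖u‖ ^ 2) = ∑' x, ENNReal.ofReal (‖u x‖ ^ 2) := by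
  rw [norm_sq_eq_tsum, ENNReal.ofReal_tsum_of_nonneg (fun _ => by positivity)
    (hasSum_norm_sq u).summable]

theorem norm_le_of_forall_le {c : ℝ} (hc : 0 ≤ c) {u v : ℓ^2(G, ℂ)}
    (h : ∀ x, ‖u x‖ ≤ c * ‖v x‖) : ‖u‖ ≤ c * ‖v‖ := by
  refine le_of_sq_le_sq ?_ (by positivity)
  rw [mul_pow]
  refine hasSum_le (fun x => ?_) (hasSum_norm_sq u) ((hasSum_norm_sq v).mul_left (c ^ 2))
  rw [← mul_pow]
  gcongr
  exact h x

/-- Dominated convergence in `ℓ²`: a fixed square summable majorant makes pointwise convergence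
imply norm convergence. -/
theorem tendsto_of_forall_tendsto {C : ℝ} {w : ℕ → ℓ^2(G, ℂ)} {w' u : ℓ^2(G, ℂ)}
    (hle : ∀ k x, ‖w k x - w' x‖ ≤ C * ‖u x‖)
    (h : ∀ x, Tendsto (fun k => w k x) atTop (𝓝 (w' x))) : Tendsto w atTop (𝓝 w') := by
  rw [tendsto_iff_norm_sub_tendsto_zero]
  have h1 : Tendsto (fun k => ‖w k - w'‖ ^ 2) atTop (𝓝 0) := by
    simp_rw [norm_sq_eq_tsum]
    rw [← tsum_zero (α := ℝ) (β := G)]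
    refine tendsto_tsum_of_dominated_convergence (bound := fun x => C ^ 2 * ‖u x‖ ^ 2)
      ((hasSum_norm_sq u).summable.mul_left _) (fun x => ?_) (Eventually.of_forall fun k x => ?_)
    · have := ((h x).sub_const (w' x)).norm.pow 2
      simpa using this
    · rw [Real.norm_of_nonneg (by positivity), ← mul_pow]
      gcongr
      exact hle k x
  have h2 := h1.sqrt
  simpa using h2

theorem mulOp_apply (a : ℓ^∞(G, ℝ)) (u : ℓ^2(G, ℂ)) (x : G) : mulOp a u x = a x * u x := rfl

theorem isSelfAdjoint_mulOp (a : ℓ^∞(G, ℝ)) : IsSelfAdjoint (mulOp a) := by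
  rw [ContinuousLinearMap.isSelfAdjoint_iff_isSymmetric]
  intro u v
  change inner ℂ (mulOp a u) v = inner ℂ u (mulOp a v)
  rw [lp.inner_eq_tsum, lp.inner_eq_tsum]
  refine tsum_congr fun x => ?_
  simp only [mulOp_apply, RCLike.inner_apply, map_mul, Complex.conj_ofReal]
  ring

/-- The characteristic function of a set as a bounded function. -/
def indicatorFun (S : Set G) : ℓ^∞(G, ℝ) :=
  ⟨S.indicator 1, memℓp_infty ⟨1, by
    rintro _ ⟨x, rfl⟩
    by_cases hx : x ∈ S <;> simp [hx]⟩⟩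

/-- Restriction of `u` to `S`, extended by zero. -/
def trunc (S : Set G) : ℓ^2(G, ℂ) →L[ℂ] ℓ^2(G, ℂ) := mulOp (indicatorFun S)

open Classical in
theorem trunc_apply (S : Set G) (u : ℓ^2(G, ℂ)) (x : G) :
    trunc S u x = if x ∈ S then u x else 0 := by
  rw [trunc, mulOp_apply]
  by_cases hx : x ∈ S <;> simp [indicatorFun, hx]

theorem trunc_apply_of_mem {S : Set G} {x : G} (hx : x ∈ S) (u : ℓ^2(G, ℂ)) :
    trunc S u x = u x := by rw [trunc_apply, if_pos hx]

theorem trunc_apply_of_notMem {S : Set G} {x : G} (hx : x ∉ S) (u : ℓ^2(G, ℂ)) :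
    trunc S u x = 0 := by rw [trunc_apply, if_neg hx]

/-- Evaluation of `u` at the points of a finite set. -/
def evalOn (S : Finset G) : ℓ^2(G, ℂ) →L[ℂ] (S → ℂ) :=
  ContinuousLinearMap.pi fun x => lp.evalCLM ℂ (fun _ : G => ℂ) 2 (x : G)

/-- Vectors with disjoint supports are orthogonal. -/
theorem norm_add_sq_of_disjoint {u v : ℓ^2(G, ℂ)} (h : ∀ x, u x = 0 ∨ v x = 0) :
    ‖u + v‖ ^ 2 = ‖u‖ ^ 2 + ‖v‖ ^ 2 := by
  refine (hasSum_norm_sq (u + v)).unique ?_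
  convert (hasSum_norm_sq u).add (hasSum_norm_sq v) using 2 with x
  rcases h x with h | h <;> simp [h]

end Basic

/-! ### Shifts, Laplacians and limit operators on a discrete abelian group. -/

section Group

variable {G : Type*} [AddCommGroup G]

theorem shift_apply (g : G) (u : ℓ^2(G, ℂ)) (x : G) : shift g u x = u (x - g) := rfl

theorem norm_shift_apply (g : G) (u : ℓ^2(G, ℂ)) : ‖shift g u‖ = ‖u‖ := norm_shift g u

theorem adjoint_shift (g : G) : ContinuousLinearMap.adjoint (shift g) = shift (-g) := by
  refine Eq.symm ((ContinuousLinearMap.eq_adjoint_iff _ _).2 fun u v => ?_)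
  rw [lp.inner_eq_tsum, lp.inner_eq_tsum, ← (Equiv.subRight g).tsum_eq]
  refine tsum_congr fun x => ?_
  simp [shift_apply]

/-- Shifts to infinity are weakly null. For finitely supported `u` the pairing only involves the
values of `v` at `x + h k`, which tend to zero; approximation handles general `u`, since shifts are
isometric. -/
theorem tendsto_inner_shift {h : ℕ → G} (hh : Tendsto h atTop cofinite) (u v : ℓ^2(G, ℂ)) :
    Tendsto (fun k => inner ℂ v (shift (h k) u)) atTop (𝓝 0) := by
  classical
  have hv : Tendsto (fun x => v x) cofinite (𝓝 0) := by
    have h1 := (hasSum_norm_sq v).summable.tendsto_cofinite_zero.sqrt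
    rw [tendsto_zero_iff_norm_tendsto_zero]
    simpa using h1
  have hfin : ∀ s : Finset G, Tendsto
      (fun k => inner ℂ v (shift (h k) (∑ x ∈ s, lp.single 2 x (u x)))) atTop (𝓝 0) := by
    intro s
    simp only [map_sum, inner_sum]
    have h0 : (0 : ℂ) = ∑ x ∈ s, 0 := by simp
    rw [h0]
    refine tendsto_finsetSum _ fun x _ => ?_
    have h1 : ∀ k, inner ℂ v (shift (h k) (lp.single 2 x (u x)))
        = inner ℂ (v (x + h k)) (u x) := fun k => by
      rw [← ContinuousLinearMap.adjoint_inner_left, adjoint_shift, lp.inner_single_right,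
        shift_apply, sub_neg_eq_add]
    simp_rw [h1]
    have h2 : Tendsto (fun k => x + h k) atTop cofinite :=
      (add_right_injective x).tendsto_cofinite.comp hh
    have h3 := (hv.comp h2).inner (𝕜 := ℂ) (tendsto_const_nhds (x := u x))
    simpa using h3
  rw [Metric.tendsto_nhds]
  intro ε hε
  have hs : HasSum (fun x => lp.single 2 x (u x)) u := lp.hasSum_single (by norm_num) u
  obtain ⟨s, hs⟩ := ((Metric.tendsto_nhds.1 hs) (ε / 2 / (‖v‖ + 1)) (by positivity)).exists
  filter_upwards [(Metric.tendsto_nhds.1 (hfin s)) (ε / 2) (by positivity)] with k hk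
  rw [dist_zero_right] at hk ⊢
  rw [dist_comm, dist_eq_norm, lt_div_iff₀ (by positivity)] at hs
  set w := ∑ x ∈ s, lp.single 2 x (u x)
  have h1 : inner ℂ v (shift (h k) u)
      = inner ℂ v (shift (h k) w) + inner ℂ v (shift (h k) (u - w)) := by
    rw [← inner_add_right, ← map_add]; simp
  have h2 : ‖inner ℂ v (shift (h k) (u - w))‖ ≤ ‖v‖ * ‖u - w‖ := by
    rw [← norm_shift_apply (h k) (u - w)]
    exact norm_inner_le_norm _ _
  have h3 := norm_nonneg (u - w)
  rw [h1]
  refine (norm_add_le _ _).trans_lt ?_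
  nlinarith

/-- Points of the spectra of limit operators belong to the essential spectrum. -/
theorem mem_essSpectrum_of_isLimitOperator {A : ℓ^2(G, ℂ) →L[ℂ] ℓ^2(G, ℂ)} {z : ℂ}
    (H : ∀ ε > 0, ∃ h A', IsLimitOperator A h A' ∧
      ∃ u : ℓ^2(G, ℂ), u ≠ 0 ∧ ‖(A' - z • ContinuousLinearMap.id ℂ ℓ^2(G, ℂ)) u‖ ≤ ε * ‖u‖) : z ∈ essSpectrum A := by
  intro hF
  obtain ⟨c, hc, hb⟩ := exists_le_norm_of_weaklyNull hF
  -- The constant `c` depends on `A - z` only, not on the sequence, so `A'` and `h` may be chosen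
  -- after it.
  obtain ⟨h, A', hA', u, hu, hle⟩ := H (c / 2) (by positivity)
  have h1 : Tendsto (fun k => ‖(A - z • ContinuousLinearMap.id ℂ ℓ^2(G, ℂ)) (shift (h k) u)‖) atTop
      (𝓝 ‖(A' - z • ContinuousLinearMap.id ℂ ℓ^2(G, ℂ)) u‖) := by
    have h2 := ((hA'.2.1 u).sub_const (z • u)).norm
    refine h2.congr fun k => ?_
    rw [← norm_shift_apply (-h k) ((A - z • ContinuousLinearMap.id ℂ ℓ^2(G, ℂ)) (shift (h k) u))]
    congr 1
    have h3 : shift (-h k) (shift (h k) u) = u := by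
      ext x; simp [shift_apply]
    simp [h3]
  have := hb _ ‖u‖ _ (fun v => tendsto_inner_shift hA'.1 u v) (fun k => norm_shift_apply _ _) h1
  have := norm_pos_iff.2 hu
  nlinarith

variable {ι : Type*} [Fintype ι]

/-- The discrete Laplacian `∑_j (2 I - V_{E j} - V_{-E j})`. -/
def lap (E : ι → G) : ℓ^2(G, ℂ) →L[ℂ] ℓ^2(G, ℂ) :=
  ∑ j, ((2 : ℂ) • ContinuousLinearMap.id ℂ _ - shift (E j) - shift (-E j))

theorem lap_eq_sum (E : ι → G) (u : ℓ^2(G, ℂ)) :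
    lap E u = ∑ j, ((2 : ℂ) • u - shift (E j) u - shift (-E j) u) := by
  simp only [lap, sum_apply]
  rfl

theorem lap_apply (E : ι → G) (u : ℓ^2(G, ℂ)) (x : G) :
    lap E u x = ∑ j, (2 * u x - u (x - E j) - u (x + E j)) := by
  rw [lap_eq_sum, sum_eval]
  refine Finset.sum_congr rfl fun j _ => ?_
  simp only [sub_eval, smul_eval, shift_apply, sub_neg_eq_add]

theorem isSelfAdjoint_lap (E : ι → G) : IsSelfAdjoint (lap E) := by
  rw [lap]
  refine isSelfAdjoint_sum _ fun j _ => ?_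
  rw [ContinuousLinearMap.isSelfAdjoint_iff', sub_sub, map_sub, map_add, adjoint_shift,
    adjoint_shift, neg_neg, add_comm (shift (-E j))]
  congr 1
  exact (IsSelfAdjoint.smul (show star (2 : ℂ) = 2 by simp) (.one _))

theorem lap_shift (E : ι → G) (g : G) (u : ℓ^2(G, ℂ)) : lap E (shift g u) = shift g (lap E u) := by
  ext x
  simp only [lap_apply, shift_apply]
  simp only [sub_right_comm, sub_add_eq_add_sub]

/-- Once centred at twice the number of directions, the Laplacian is a sum of that many isometries
up to sign. This places its spectrum in `[0, 4N]` without a Fourier transform. -/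
theorem norm_lap_sub_le (E : ι → G) (u : ℓ^2(G, ℂ)) :
    ‖lap E u - ((2 * Fintype.card ι : ℝ) : ℂ) • u‖ ≤ 2 * Fintype.card ι * ‖u‖ := by
  have h1 : lap E u - ((2 * Fintype.card ι : ℝ) : ℂ) • u
      = ∑ j, (- shift (E j) u - shift (-E j) u) := by
    have h2 : ((2 * Fintype.card ι : ℝ) : ℂ) • u = ∑ _j : ι, (2 : ℂ) • u := by
      rw [Finset.sum_const, Finset.card_univ, ← Nat.cast_smul_eq_nsmul ℂ, smul_smul]
      push_cast
      rw [mul_comm]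
    rw [lap_eq_sum, h2, ← Finset.sum_sub_distrib]
    refine Finset.sum_congr rfl fun j _ => ?_
    abel
  rw [h1]
  refine (norm_sum_le _ _).trans ?_
  refine (Finset.sum_le_card_nsmul _ _ (2 * ‖u‖) fun j _ => ?_).trans_eq ?_
  · refine (norm_sub_le _ _).trans ?_
    rw [norm_neg, norm_shift_apply, norm_shift_apply, two_mul]
  · rw [Finset.card_univ, nsmul_eq_mul]; ring

/-- The Schrödinger operator with the potential `Φ`. -/
def schr (E : ι → G) (Φ : ℓ^∞(G, ℝ)) : ℓ^2(G, ℂ) →L[ℂ] ℓ^2(G, ℂ) := lap E + mulOp Φ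

theorem schr_apply (E : ι → G) (Φ : ℓ^∞(G, ℝ)) (u : ℓ^2(G, ℂ)) (x : G) :
    schr E Φ u x = lap E u x + Φ x * u x := rfl

theorem isSelfAdjoint_schr (E : ι → G) (Φ : ℓ^∞(G, ℝ)) : IsSelfAdjoint (schr E Φ) :=
  (isSelfAdjoint_lap E).add (isSelfAdjoint_mulOp Φ)

theorem isLimitOperator_schr (E : ι → G) {Φ Ψ : ℓ^∞(G, ℝ)} {h : ℕ → G}
    (hh : Tendsto h atTop cofinite)
    (hΦ : ∀ x, Tendsto (fun k => Φ (x + h k)) atTop (𝓝 (Ψ x))) :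
    IsLimitOperator (schr E Φ) h (schr E Ψ) := by
  have key : ∀ u, Tendsto (fun j => shift (-h j) (schr E Φ (shift (h j) u))) atTop
      (𝓝 (schr E Ψ u)) := by
    intro u
    have h1 : ∀ k x, shift (-h k) (schr E Φ (shift (h k) u)) x
        = lap E u x + Φ (x + h k) * u x := fun k x => by
      rw [shift_apply, schr_apply, lap_shift]
      simp [shift_apply]
    refine tendsto_of_forall_tendsto (C := ‖Φ‖ + ‖Ψ‖) (u := u) (fun k x => ?_) fun x => ?_
    · rw [h1, schr_apply, add_sub_add_left_eq_sub, ← sub_mul, norm_mul, ← Complex.ofReal_sub,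
        Complex.norm_real]
      gcongr
      exact (norm_sub_le _ _).trans (add_le_add (lp.norm_apply_le_norm (by simp) Φ _)
        (lp.norm_apply_le_norm (by simp) Ψ _))
    · simp_rw [h1]
      exact (((Complex.continuous_ofReal.tendsto _).comp (hΦ x)).mul_const _).const_add _
  refine ⟨hh, key, ?_⟩
  rw [ContinuousLinearMap.isSelfAdjoint_iff'.1 (isSelfAdjoint_schr E Φ),
    ContinuousLinearMap.isSelfAdjoint_iff'.1 (isSelfAdjoint_schr E Ψ)]
  exact key

theorem jacobi_eq (φ : ℓ^∞(ℤ, ℝ)) : jacobi φ = schr (fun _ : Unit => 1) φ := by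
  simp [jacobi, schr, lap]

/-- A Laplacian plus a constant has its spectrum in an interval: approximate eigenvalues. -/
theorem le_norm_schr_of_const (E : ι → G) {Φ : ℓ^∞(G, ℝ)} {c μ r : ℝ} {u : ℓ^2(G, ℂ)}
    (hu : ∀ x, u x ≠ 0 → Φ x = c) (hr : r ≤ |μ - c - 2 * Fintype.card ι| - 2 * Fintype.card ι) :
    r * ‖u‖ ≤ ‖(schr E Φ - (μ : ℂ) • ContinuousLinearMap.id ℂ ℓ^2(G, ℂ)) u‖ := by
  -- Multiplication is local, so only the values of `Φ` on the support of `u` enter. The scalar left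
  -- after centring is compared with the norm of the centred Laplacian.
  have h1 : (schr E Φ - (μ : ℂ) • ContinuousLinearMap.id ℂ ℓ^2(G, ℂ)) u
      = (lap E u - ((2 * Fintype.card ι : ℝ) : ℂ) • u)
        - ((μ - c - 2 * Fintype.card ι : ℝ) : ℂ) • u := by
    ext x
    simp only [sub_smul_id_apply, sub_eval, smul_eval, schr_apply]
    by_cases hx : u x = 0
    · simp [hx]
    · rw [hu x hx]
      push_cast
      ring
  rw [h1]
  have h2 := norm_lap_sub_le E u
  have h3 : ‖((μ - c - 2 * Fintype.card ι : ℝ) : ℂ) • u‖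
      = |μ - c - 2 * Fintype.card ι| * ‖u‖ := by
    rw [norm_smul, Complex.norm_real, Real.norm_eq_abs]
  have h4 := norm_sub_norm_le (((μ - c - 2 * Fintype.card ι : ℝ) : ℂ) • u)
    (lap E u - ((2 * Fintype.card ι : ℝ) : ℂ) • u)
  rw [h3, norm_sub_rev (_ • u) (_ - _)] at h4
  nlinarith [mul_le_mul_of_nonneg_right hr (norm_nonneg u)]

end Group

/-! ### Følner sets: plane waves for the Laplacian, and localization of approximate eigenvectors. -/

section Folner

variable {G : Type*} [AddCommGroup G] {ι : Type*} [Fintype ι]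

open Classical in
/-- The characteristic function of a finite set as an element of `ℓ²`. -/
def charFun (F : Finset G) : ℓ^2(G, ℂ) := ∑ x ∈ F, lp.single 2 x 1

omit [AddCommGroup G] in
open Classical in
theorem charFun_apply (F : Finset G) (x : G) : charFun F x = if x ∈ F then 1 else 0 := by
  rw [charFun, sum_eval]
  simp only [lp.single_apply, Pi.single_apply]
  rw [Finset.sum_ite_eq]

omit [AddCommGroup G] in
theorem norm_charFun_sq (F : Finset G) : ‖charFun F‖ ^ 2 = F.card := by
  classical
  rw [norm_sq_eq_tsum, tsum_eq_sum (s := F) (fun x hx => by simp [charFun_apply, hx])]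
  simp +contextual [charFun_apply]

omit [AddCommGroup G] in
theorem charFun_ne_zero {F : Finset G} (hF : F.Nonempty) : charFun F ≠ 0 := by
  intro h
  have h1 := norm_charFun_sq F
  rw [h, norm_zero, zero_pow two_ne_zero] at h1
  have h2 := hF.card_pos
  exact h2.ne (by exact_mod_cast h1)

/-- The squared norm counts the symmetric difference of `F` and `F + g`. Its two halves have equal
cardinality, whence the factor 2. -/
theorem norm_charFun_sub_shift_sq_le {F A : Finset G} {g : G} (hA : ∀ x ∈ F, x - g ∉ F → x ∈ A) :
    ‖charFun F - shift g (charFun F)‖ ^ 2 ≤ 2 * A.card := by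
  classical
  have h1 : inner ℂ (charFun F) (shift g (charFun F)) = ({x ∈ F | x - g ∈ F}.card : ℂ) := by
    conv_lhs => rw [charFun, sum_inner]
    simp only [lp.inner_single_left, shift_apply]
    rw [← charFun]
    simp [charFun_apply]
  have h2 := Finset.card_filter_add_card_filter_not (s := F) (fun x => x - g ∈ F)
  have h3 : {x ∈ F | x - g ∉ F}.card ≤ A.card := Finset.card_le_card fun x hx => by
    rw [Finset.mem_filter] at hx
    exact hA x hx.1 hx.2
  have h4 : ({x ∈ F | x - g ∉ F}.card : ℝ) ≤ A.card := by exact_mod_cast h3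
  rw [norm_sub_sq (𝕜 := ℂ), h1, norm_shift_apply, norm_charFun_sq, ← h2]
  push_cast
  simp only [RCLike.natCast_re]
  linarith

/-- There are finite sets which are almost invariant under the shifts by `E j`. -/
def IsFolner (E : ι → G) : Prop :=
  ∀ δ > 0, ∃ F : Finset G, F.Nonempty ∧
    ∀ j, ‖charFun F - shift (E j) (charFun F)‖ ^ 2 ≤ δ * ‖charFun F‖ ^ 2

/-- Every point of `[0, 4N]` is an approximate eigenvalue of the Laplacian. -/
theorem exists_approx_eigenvector_lap {E : ι → G} (hE : IsFolner E) (σ : G →+ ℤ)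
    (hσ : ∀ j, σ (E j) = 1) {s : ℝ} (hs : s ∈ Icc 0 (4 * (Fintype.card ι : ℝ))) {ε : ℝ}
    (hε : 0 < ε) :
    ∃ f : ℓ^2(G, ℂ), f ≠ 0 ∧ ‖lap E f - (s : ℂ) • f‖ ≤ ε * ‖f‖ := by
  classical
  set n := Fintype.card ι with hn
  -- The right side is the symbol of the Laplacian at a character taking the value `exp (iθ)` on
  -- every `E j`; already these diagonal characters exhaust `[0, 4n]`. The homomorphism `σ` supplies
  -- such a character.
  obtain ⟨θ, hθ⟩ : ∃ θ : ℝ, s = n * (2 - 2 * Real.cos θ) := by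
    rcases Nat.eq_zero_or_pos n with h0 | h0
    · refine ⟨0, ?_⟩
      rw [h0] at hs ⊢
      simp only [Nat.cast_zero, mul_zero] at hs
      rw [le_antisymm hs.2 hs.1]; simp
    · have h1 : (0 : ℝ) < n := by exact_mod_cast h0
      refine ⟨Real.arccos (1 - s / (2 * n)), ?_⟩
      have h2 : s / (2 * n) ≤ 2 := by rw [div_le_iff₀ (by positivity)]; linarith [hs.2]
      have h3 : 0 ≤ s / (2 * n) := div_nonneg hs.1 (by positivity)
      rw [Real.cos_arccos (by linarith) (by linarith)]
      field_simp
      ring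
  set κ : G → ℂ := fun x => Complex.exp ((θ * σ x : ℝ) * Complex.I) with hκ
  have hκn : ∀ x, ‖κ x‖ = 1 := fun x => Complex.norm_exp_ofReal_mul_I _
  have hκadd : ∀ x y, κ (x + y) = κ x * κ y := fun x y => by
    simp only [hκ, ← Complex.exp_add, map_add]
    congr 1
    push_cast
    ring
  have hκs : ∀ j, κ (E j) + κ (-E j) = 2 * Real.cos θ := fun j => by
    simp only [hκ, map_neg, hσ]
    rw [Complex.ofReal_cos, Complex.cos]
    push_cast
    ring_nf
  -- The `2n` shift errors must add up to at most `ε`; the extra 1 avoids division by zero when `n =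
  -- 0`.
  obtain ⟨F, hne, hF⟩ := hE ((ε / (2 * n + 1)) ^ 2) (by positivity)
  set φ := charFun F with hφ
  have hF' : ∀ j, ‖φ - shift (E j) φ‖ ≤ ε / (2 * n + 1) * ‖φ‖ := fun j => by
    refine le_of_sq_le_sq ?_ (by positivity)
    rw [mul_pow]
    exact hF j
  have hF'' : ∀ j, ‖φ - shift (-E j) φ‖ ≤ ε / (2 * n + 1) * ‖φ‖ := fun j => by
    refine le_trans (le_of_eq ?_) (hF' j)
    rw [← norm_shift_apply (E j) (φ - shift (-E j) φ), norm_sub_rev]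
    congr 1
    ext x
    simp only [sub_eval, shift_apply, map_sub]
    simp
  set f : ℓ^2(G, ℂ) := ∑ x ∈ F, lp.single 2 x (κ x) with hf
  have hfx : ∀ x, f x = κ x * φ x := fun x => by
    rw [hf, sum_eval, hφ, charFun_apply]
    simp only [lp.single_apply, Pi.single_apply]
    rw [Finset.sum_ite_eq]
    simp
  have hfφ : ‖f‖ = ‖φ‖ := by
    refine le_antisymm ?_ ?_
    · simpa using norm_le_of_forall_le (c := 1) zero_le_one (u := f) (v := φ)
        fun x => by rw [hfx, norm_mul, hκn]
    · simpa using norm_le_of_forall_le (c := 1) zero_le_one (u := φ) (v := f)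
        fun x => by rw [hfx, norm_mul, hκn, one_mul, one_mul]
  refine ⟨f, ?_, ?_⟩
  · rw [← norm_pos_iff, hfφ, norm_pos_iff]
    exact charFun_ne_zero hne
  -- For `f = κ φ` with a character `κ`, the failure of the eigenvalue equation under one shift is
  -- exactly the failure of `φ` to be shift invariant.
  have hshift : ∀ g, ‖κ (-g) • f - shift g f‖ ≤ ‖φ - shift g φ‖ := fun g => by
    rw [← one_mul ‖φ - shift g φ‖]
    refine norm_le_of_forall_le zero_le_one fun x => ?_
    simp only [sub_eval, smul_eval, shift_apply, hfx]
    rw [sub_eq_add_neg x g, hκadd x (-g), show κ (-g) * (κ x * φ x) - κ x * κ (-g) * φ (x + -g)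
      = κ x * κ (-g) * (φ x - φ (x + -g)) by ring, norm_mul, norm_mul, hκn, hκn, one_mul]
  have hsum : lap E f - (s : ℂ) • f
      = ∑ j, ((κ (-E j) • f - shift (E j) f) + (κ (E j) • f - shift (-E j) f)) := by
    have h1 : (s : ℂ) • f = ∑ j, (2 - (κ (E j) + κ (-E j))) • f := by
      simp only [hκs]
      rw [Finset.sum_const, Finset.card_univ, ← Nat.cast_smul_eq_nsmul ℂ, smul_smul, hθ]
      push_cast
      rfl
    rw [lap_eq_sum, h1, ← Finset.sum_sub_distrib]
    refine Finset.sum_congr rfl fun j _ => ?_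
    rw [sub_smul, add_smul]
    abel
  rw [hsum]
  refine (norm_sum_le _ _).trans ?_
  refine (Finset.sum_le_card_nsmul _ _ (2 * (ε / (2 * n + 1) * ‖φ‖)) fun j _ => ?_).trans ?_
  · refine (norm_add_le _ _).trans ?_
    have h1 := (hshift (E j)).trans (hF' j)
    have h2 := (hshift (-E j)).trans (hF'' j)
    rw [neg_neg] at h2
    linarith
  · rw [Finset.card_univ, nsmul_eq_mul, hfφ, ← hn]
    have h1 : (n : ℝ) * (2 * (ε / (2 * n + 1) * ‖φ‖)) = (2 * n / (2 * n + 1)) * (ε * ‖φ‖) := by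
      field_simp
    rw [h1]
    refine mul_le_of_le_one_left (by positivity) ?_
    rw [div_le_one (by positivity)]
    linarith

/-- The total mass of a convolution is the product of the masses. It evaluates sums over all
translates of the cutoff in the averaging argument. -/
theorem tsum_tsum_sub_mul (f g : G → ℝ≥0∞) :
    ∑' y, ∑' x, f (x - y) * g x = (∑' x, f x) * ∑' x, g x := by
  rw [ENNReal.tsum_comm]
  simp_rw [ENNReal.tsum_mul_right]
  rw [← ENNReal.tsum_mul_left]
  refine tsum_congr fun x => ?_
  rw [← (Equiv.subLeft x).tsum_eq f]
  rfl

/-- A localization argument: approximate eigenvectors can be truncated to translates of a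
Følner set. -/
theorem exists_trunc_norm_le {E : ι → G} (Φ : ℓ^∞(G, ℝ)) (z : ℂ) {F : Finset G}
    (hne : F.Nonempty) {δ ε : ℝ} (hε : 0 < ε)
    (hF : ∀ j, ‖charFun F - shift (E j) (charFun F)‖ ^ 2 ≤ δ * ‖charFun F‖ ^ 2)
    (hδ : δ * (16 * (Fintype.card ι ^ 2 + 1)) ≤ ε ^ 2) {u : ℓ^2(G, ℂ)} (hu : u ≠ 0)
    (hle : ‖(schr E Φ - z • ContinuousLinearMap.id ℂ ℓ^2(G, ℂ)) u‖ ≤ ε / 4 * ‖u‖) :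
    ∃ y, trunc {x | x - y ∈ F} u ≠ 0 ∧
      ‖(schr E Φ - z • ContinuousLinearMap.id ℂ ℓ^2(G, ℂ)) (trunc {x | x - y ∈ F} u)‖
        ≤ ε * ‖trunc {x | x - y ∈ F} u‖ := by
  by_contra! hcon
  set T := schr E Φ - z • ContinuousLinearMap.id ℂ ℓ^2(G, ℂ) with hT
  set φ := charFun F with hφ
  set n := Fintype.card ι with hn
  set v : G → ℓ^2(G, ℂ) := fun y => trunc {x | x - y ∈ F} u with hv
  have hvx : ∀ y x, v y x = φ (x - y) * u x := fun y x => by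
    rw [hφ, charFun_apply]
    by_cases hx : x - y ∈ F
    · rw [if_pos hx, one_mul]; exact trunc_apply_of_mem (S := {x | x - y ∈ F}) hx u
    · rw [if_neg hx, zero_mul]; exact trunc_apply_of_notMem (S := {x | x - y ∈ F}) hx u
  have hTx : ∀ w x, T w x = ∑ j, (2 * w x - w (x - E j) - w (x + E j)) + Φ x * w x - z * w x :=
    fun w x => by
      rw [hT, sub_smul_id_apply, sub_eval, smul_eval, schr_apply, lap_apply]
  -- The commutator of `T` with the cutoff involves only differences of `φ` along the `E j`, which
  -- the Følner bound controls. Summing the squares over all `y` bounds the residuals of the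
  -- truncations against their masses.
  have hTv : ∀ y x, T (v y) x = φ (x - y) * T u x
      + ∑ j, (φ (x - y) - φ (x - y - E j)) * u (x - E j)
      + ∑ j, (φ (x - y) - φ (x - y + E j)) * u (x + E j) := by
    intro y x
    rw [hTx, hTx]
    simp only [hvx]
    rw [mul_sub, mul_add, Finset.mul_sum]
    have : ∀ j, 2 * (φ (x - y) * u x) - φ (x - E j - y) * u (x - E j)
        - φ (x + E j - y) * u (x + E j) = φ (x - y) * (2 * u x - u (x - E j) - u (x + E j))
        + (φ (x - y) - φ (x - y - E j)) * u (x - E j)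
        + (φ (x - y) - φ (x - y + E j)) * u (x + E j) := fun j => by
      rw [sub_right_comm x (E j) y, add_sub_right_comm x (E j) y]; ring
    simp only [this, Finset.sum_add_distrib]
    ring
  have hreal : ∀ a b c : ℂ, ‖a + b + c‖ ^ 2 ≤ 3 * (‖a‖ ^ 2 + ‖b‖ ^ 2 + ‖c‖ ^ 2) := by
    intro a b c
    have h1 := norm_add₃_le (a := a) (b := b) (c := c)
    have h2 := norm_nonneg (a + b + c)
    nlinarith [sq_nonneg (‖a‖ - ‖b‖), sq_nonneg (‖a‖ - ‖c‖), sq_nonneg (‖b‖ - ‖c‖)]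
  have hsum : ∀ b : ι → ℂ, ‖∑ j, b j‖ ^ 2 ≤ n * ∑ j, ‖b j‖ ^ 2 := by
    intro b
    refine (pow_le_pow_left₀ (norm_nonneg _) (norm_sum_le _ _) 2).trans ?_
    exact sq_sum_le_card_mul_sum_sq
  have hpt : ∀ y x, ENNReal.ofReal (‖T (v y) x‖ ^ 2) ≤ 3 *
      (ENNReal.ofReal (‖φ (x - y)‖ ^ 2) * ENNReal.ofReal (‖T u x‖ ^ 2)
      + n * ∑ j, ENNReal.ofReal (‖φ (x - y) - φ (x - y - E j)‖ ^ 2)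
          * ENNReal.ofReal (‖u (x - E j)‖ ^ 2)
      + n * ∑ j, ENNReal.ofReal (‖φ (x - y) - φ (x - y + E j)‖ ^ 2)
          * ENNReal.ofReal (‖u (x + E j)‖ ^ 2)) := by
    intro y x
    simp only [← ENNReal.ofReal_mul (sq_nonneg _), ← mul_pow, ← norm_mul]
    rw [← ENNReal.ofReal_sum_of_nonneg (fun _ _ => sq_nonneg _),
      ← ENNReal.ofReal_sum_of_nonneg (fun _ _ => sq_nonneg _), ← ENNReal.ofReal_natCast n,
      ← ENNReal.ofReal_mul (by positivity), ← ENNReal.ofReal_mul (by positivity),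
      ← ENNReal.ofReal_add (by positivity) (by positivity),
      ← ENNReal.ofReal_add (by positivity) (by positivity),
      show (3 : ℝ≥0∞) = ENNReal.ofReal 3 by simp, ← ENNReal.ofReal_mul (by positivity), hTv]
    refine ENNReal.ofReal_le_ofReal ((hreal _ _ _).trans ?_)
    gcongr
    · exact hsum _
    · exact hsum _
  set P := ENNReal.ofReal (‖φ‖ ^ 2) with hP
  set U := ENNReal.ofReal (‖u‖ ^ 2) with hU
  have hUe : U = ∑' x, ENNReal.ofReal (‖u x‖ ^ 2) := ofReal_norm_sq u
  have hV : ∑' y, ENNReal.ofReal (‖v y‖ ^ 2) = P * U := by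
    simp only [ofReal_norm_sq (v _), hvx, norm_mul, mul_pow, ENNReal.ofReal_mul (sq_nonneg _)]
    rw [tsum_tsum_sub_mul (fun x => ENNReal.ofReal (‖φ x‖ ^ 2))
      (fun x => ENNReal.ofReal (‖u x‖ ^ 2)), hP, hU, ofReal_norm_sq, ofReal_norm_sq]
  have hdiff : ∀ j, ∑' x, ENNReal.ofReal (‖φ x - φ (x - E j)‖ ^ 2) ≤ ENNReal.ofReal δ * P := by
    intro j
    have h1 := ofReal_norm_sq (φ - shift (E j) φ)
    simp only [sub_eval, shift_apply] at h1
    rw [← h1, hP, ← ENNReal.ofReal_mul' (sq_nonneg _)]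
    exact ENNReal.ofReal_le_ofReal (hF j)
  have hdiff' : ∀ j, ∑' x, ENNReal.ofReal (‖φ x - φ (x + E j)‖ ^ 2) ≤ ENNReal.ofReal δ * P := by
    intro j
    refine le_trans (le_of_eq ?_) (hdiff j)
    rw [← (Equiv.subRight (E j)).tsum_eq]
    refine tsum_congr fun x => ?_
    simp [norm_sub_rev]
  have e1 : ∑' y, ∑' x, ENNReal.ofReal (‖φ (x - y)‖ ^ 2) * ENNReal.ofReal (‖T u x‖ ^ 2)
      = P * ENNReal.ofReal (‖T u‖ ^ 2) := by
    rw [tsum_tsum_sub_mul (fun x => ENNReal.ofReal (‖φ x‖ ^ 2))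
      (fun x => ENNReal.ofReal (‖T u x‖ ^ 2)), hP, ofReal_norm_sq, ofReal_norm_sq]
  have e2 : ∀ j, ∑' y, ∑' x, ENNReal.ofReal (‖φ (x - y) - φ (x - y - E j)‖ ^ 2)
      * ENNReal.ofReal (‖u (x - E j)‖ ^ 2)
      = (∑' x, ENNReal.ofReal (‖φ x - φ (x - E j)‖ ^ 2)) * U := fun j => by
    rw [tsum_tsum_sub_mul (fun x => ENNReal.ofReal (‖φ x - φ (x - E j)‖ ^ 2))
      (fun x => ENNReal.ofReal (‖u (x - E j)‖ ^ 2)), hUe,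
      ← (Equiv.subRight (E j)).tsum_eq (fun x => ENNReal.ofReal (‖u x‖ ^ 2))]
    rfl
  have e3 : ∀ j, ∑' y, ∑' x, ENNReal.ofReal (‖φ (x - y) - φ (x - y + E j)‖ ^ 2)
      * ENNReal.ofReal (‖u (x + E j)‖ ^ 2)
      = (∑' x, ENNReal.ofReal (‖φ x - φ (x + E j)‖ ^ 2)) * U := fun j => by
    rw [tsum_tsum_sub_mul (fun x => ENNReal.ofReal (‖φ x - φ (x + E j)‖ ^ 2))
      (fun x => ENNReal.ofReal (‖u (x + E j)‖ ^ 2)), hUe,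
      ← (Equiv.addRight (E j)).tsum_eq (fun x => ENNReal.ofReal (‖u x‖ ^ 2))]
    rfl
  have hTV : ∑' y, ENNReal.ofReal (‖T (v y)‖ ^ 2)
      ≤ 3 * (P * ENNReal.ofReal (‖T u‖ ^ 2) + n * (n * (ENNReal.ofReal δ * P * U))
        + n * (n * (ENNReal.ofReal δ * P * U))) := by
    calc _ = ∑' y, ∑' x, ENNReal.ofReal (‖T (v y) x‖ ^ 2) := by simp only [ofReal_norm_sq]
      _ ≤ _ := ENNReal.tsum_le_tsum fun y => ENNReal.tsum_le_tsum fun x => hpt y x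
      _ = 3 * (P * ENNReal.ofReal (‖T u‖ ^ 2)
          + n * ∑ j, (∑' x, ENNReal.ofReal (‖φ x - φ (x - E j)‖ ^ 2)) * U
          + n * ∑ j, (∑' x, ENNReal.ofReal (‖φ x - φ (x + E j)‖ ^ 2)) * U) := by
        simp only [ENNReal.tsum_mul_left, ENNReal.tsum_add,
          Summable.tsum_finsetSum (fun _ _ => ENNReal.summable)]
        rw [e1]
        simp only [e2, e3]
      _ ≤ _ := by
        gcongr
        · refine (Finset.sum_le_card_nsmul _ _ _ fun j _ => mul_le_mul_left (hdiff j) U).trans ?_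
          rw [Finset.card_univ, nsmul_eq_mul]
        · refine (Finset.sum_le_card_nsmul _ _ _ fun j _ => mul_le_mul_left (hdiff' j) U).trans ?_
          rw [Finset.card_univ, nsmul_eq_mul]
  have hlow : ENNReal.ofReal (ε ^ 2) * (P * U) ≤ ∑' y, ENNReal.ofReal (‖T (v y)‖ ^ 2) := by
    rw [← hV, ← ENNReal.tsum_mul_left]
    refine ENNReal.tsum_le_tsum fun y => ?_
    rw [← ENNReal.ofReal_mul (sq_nonneg _), ← mul_pow]
    refine ENNReal.ofReal_le_ofReal ?_
    by_cases h0 : v y = 0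
    · simp [h0]
    · exact pow_le_pow_left₀ (by positivity) (hcon y h0).le 2
  have hφ0 : 0 < ‖φ‖ ^ 2 := by
    have := norm_pos_iff.2 (charFun_ne_zero hne)
    positivity
  have hu0 : 0 < ‖u‖ ^ 2 := by
    have := norm_pos_iff.2 hu
    positivity
  have hfinal := hlow.trans hTV
  -- `ENNReal.ofReal` replaces a negative `δ` by 0, so the smallness condition is needed for `max δ
  -- 0`.
  have hδ' : max δ 0 * (16 * (n ^ 2 + 1)) ≤ ε ^ 2 := by
    rcases max_cases δ 0 with h | h
    · rw [h.1]; exact hδ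
    · rw [h.1, zero_mul]; positivity
  have hδm : 0 ≤ max δ 0 := le_max_right _ _
  rw [show ENNReal.ofReal δ = ENNReal.ofReal (max δ 0) by simp, hP, hU,
    ← ENNReal.ofReal_natCast n, show (3 : ℝ≥0∞) = ENNReal.ofReal 3 by simp] at hfinal
  rw [← ENNReal.ofReal_mul hφ0.le, ← ENNReal.ofReal_mul (sq_nonneg _),
    ← ENNReal.ofReal_mul (sq_nonneg _), ← ENNReal.ofReal_mul hδm,
    ← ENNReal.ofReal_mul (by positivity), ← ENNReal.ofReal_mul (by positivity),
    ← ENNReal.ofReal_mul (by positivity), ← ENNReal.ofReal_add (by positivity) (by positivity),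
    ← ENNReal.ofReal_add (by positivity) (by positivity), ← ENNReal.ofReal_mul (by positivity),
    ENNReal.ofReal_le_ofReal_iff (by positivity)] at hfinal
  have hTu : ‖T u‖ ^ 2 ≤ ε ^ 2 / 16 * ‖u‖ ^ 2 := by
    calc _ ≤ (ε / 4 * ‖u‖) ^ 2 := pow_le_pow_left₀ (norm_nonneg _) hle 2
      _ = _ := by ring
  have hp : 0 < ‖φ‖ ^ 2 * ‖u‖ ^ 2 := by positivity
  have h1 : ‖φ‖ ^ 2 * ‖T u‖ ^ 2 ≤ ε ^ 2 / 16 * (‖φ‖ ^ 2 * ‖u‖ ^ 2) := by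
    nlinarith
  have h2 : (n : ℝ) * (n * (max δ 0 * ‖φ‖ ^ 2 * ‖u‖ ^ 2))
      ≤ ε ^ 2 / 16 * (‖φ‖ ^ 2 * ‖u‖ ^ 2) := by
    have : (n : ℝ) ^ 2 * max δ 0 ≤ ε ^ 2 / 16 := by nlinarith
    nlinarith
  have h3 : 0 < ε ^ 2 * (‖φ‖ ^ 2 * ‖u‖ ^ 2) := by positivity
  -- Each of the three contributions is at most `ε² / 16` of the total mass. With the factor 3 from
  -- squaring a sum of three terms they give `9/16 < 1`, contradicting `hfinal`.
  linarith

/-- The shape `F` depends on `ε` alone, while the position `y` can be pushed out of any finite set.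
Failure of the Fredholm property gives an approximate eigenvector vanishing on `S + F`; a nonzero
truncation of it to `y + F` forces `y ∉ S`. -/
theorem exists_localized_approx_eigenvector {E : ι → G} (hE : IsFolner E) {Φ : ℓ^∞(G, ℝ)} {z : ℝ}
    (hz : (z : ℂ) ∈ essSpectrum (schr E Φ)) {ε : ℝ} (hε : 0 < ε) :
    ∃ F : Finset G, ∀ S : Set G, S.Finite → ∃ y ∉ S, ∃ v : ℓ^2(G, ℂ), v ≠ 0 ∧
      (∀ x, v x ≠ 0 → x - y ∈ F) ∧
      ‖(schr E Φ - (z : ℂ) • ContinuousLinearMap.id ℂ ℓ^2(G, ℂ)) v‖ ≤ ε * ‖v‖ := by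
  classical
  obtain ⟨F, hne, hF⟩ := hE (ε ^ 2 / (16 * (Fintype.card ι ^ 2 + 1))) (by positivity)
  refine ⟨F, fun S hS => ?_⟩
  obtain ⟨u, hu0, hu⟩ : ∃ u, evalOn (Finset.image₂ (· + ·) hS.toFinset F) u = 0 ∧
      ‖(schr E Φ - (z : ℂ) • ContinuousLinearMap.id ℂ ℓ^2(G, ℂ)) u‖ < ε / 4 * ‖u‖ := by
    by_contra! hcon
    exact hz (isFredholm_of_le_norm (isSelfAdjoint_sub_real_smul_id (isSelfAdjoint_schr E Φ) z)
      _ (by positivity) hcon)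
  have hune : u ≠ 0 := by
    rintro rfl
    simp at hu
  obtain ⟨y, hy, hyle⟩ := exists_trunc_norm_le Φ z hne hε hF
    (by rw [div_mul_cancel₀ _ (by positivity)]) hune hu.le
  refine ⟨y, fun hyS => hy ?_, _, hy, fun x hx => ?_, hyle⟩
  · ext x
    by_cases hx : x - y ∈ F
    · rw [trunc_apply_of_mem (S := {x | x - y ∈ F}) hx]
      have hmem : x ∈ Finset.image₂ (· + ·) hS.toFinset F :=
        Finset.mem_image₂.2 ⟨y, hS.mem_toFinset.2 hyS, x - y, hx, by abel⟩
      exact congrFun hu0 ⟨x, hmem⟩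
    · exact trunc_apply_of_notMem (S := {x | x - y ∈ F}) hx u
  · by_contra hxF
    exact hx (trunc_apply_of_notMem (S := {x | x - y ∈ F}) hxF u)

end Folner

/-- In a cube of side `L` the points that leave it under a unit shift lie on one face, a fraction
`1/L` of the cube. -/
theorem isFolner_single (N : ℕ) : IsFolner fun j : Fin N => (Pi.single j 1 : Fin N → ℤ) := by
  intro δ hδ
  obtain ⟨L, hL⟩ := exists_nat_gt (2 / δ)
  have hL0 : (0 : ℝ) < L := lt_trans (by positivity) hL
  have hL0' : 0 < L := by exact_mod_cast hL0
  set F := Fintype.piFinset fun _ : Fin N => Finset.Ico 0 (L : ℤ) with hF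
  refine ⟨F, ?_, fun j => ?_⟩
  · rw [Fintype.piFinset_nonempty]
    intro _
    exact ⟨0, by simpa using hL0'⟩
  · set A := Fintype.piFinset (Function.update (fun _ : Fin N => Finset.Ico 0 (L : ℤ)) j {0})
      with hA
    have hFA : ∀ x ∈ F, x - Pi.single j 1 ∉ F → x ∈ A := by
      intro x hx hx'
      simp only [hF, Fintype.mem_piFinset, Finset.mem_Ico, not_forall] at hx hx'
      obtain ⟨i, hi⟩ := hx'
      rw [Fintype.mem_piFinset]
      have hij : i = j := by
        by_contra h
        rw [Pi.sub_apply, Pi.single_eq_of_ne h, sub_zero] at hi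
        exact hi (hx i)
      subst hij
      intro k
      by_cases hk : k = i
      · subst hk
        rw [Pi.sub_apply, Pi.single_eq_same] at hi
        have := hx k
        rw [Function.update_self, Finset.mem_singleton]
        omega
      · rw [Function.update_of_ne hk, Finset.mem_Ico]
        exact hx k
    have hcard : L * A.card = F.card := by
      rw [hF, hA, Fintype.card_piFinset, Fintype.card_piFinset, Fintype.prod_eq_mul_prod_compl j,
        Fintype.prod_eq_mul_prod_compl j, Function.update_self]
      simp only [Finset.card_singleton, one_mul, Int.card_Ico, sub_zero, Int.toNat_natCast]
      congr 1
      refine Finset.prod_congr rfl fun k hk => ?_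
      rw [Function.update_of_ne (by simpa using hk)]
      simp
    have hcard' : (L : ℝ) * A.card = F.card := by exact_mod_cast hcard
    refine (norm_charFun_sub_shift_sq_le hFA).trans ?_
    rw [norm_charFun_sq, ← hcard', ← mul_assoc]
    rw [div_lt_iff₀ hδ] at hL
    gcongr
    linarith

theorem isFolner_one : IsFolner fun _ : Unit => (1 : ℤ) := by
  intro δ hδ
  obtain ⟨L, hL⟩ := exists_nat_gt (2 / δ)
  have hL0 : (0 : ℝ) < L := lt_trans (by positivity) hL
  have hL0' : 0 < L := by exact_mod_cast hL0
  refine ⟨Finset.Ico 0 (L : ℤ), ⟨0, by simpa using hL0'⟩, fun j => ?_⟩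
  refine (norm_charFun_sub_shift_sq_le (A := {0}) fun x hx hx' => ?_).trans ?_
  · simp only [Finset.mem_Ico, Finset.mem_singleton] at hx hx' ⊢
    omega
  · rw [div_lt_iff₀ hδ] at hL
    rw [norm_charFun_sq]
    simp only [Int.card_Ico, sub_zero, Int.toNat_natCast, Finset.card_singleton]
    push_cast
    linarith

/-! ### Values of layered potentials. -/

section Layered

variable {G : Type*} {h₁ h₂ : ℝ} {π : G → ℤ} {am a0 ap : ℓ^∞(G, ℝ)} {cm c0 cp : ℝ} {x : G}

theorem layered_apply (h₁ h₂ : ℝ) (π : G → ℤ) (am a0 ap : ℓ^∞(G, ℝ)) (x : G) :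
    layered h₁ h₂ π am a0 ap x = (Ioi h₂).indicator 1 (π x : ℝ) * ap x
      + (Icc h₁ h₂).indicator 1 (π x : ℝ) * a0 x
      + (Iio h₁).indicator 1 (π x : ℝ) * am x := rfl

theorem layered_of_lt (hh : h₁ < h₂) (hx : h₂ < π x) : layered h₁ h₂ π am a0 ap x = ap x := by
  have h1 : ¬ (π x : ℝ) ≤ h₂ := not_le.2 hx
  have h2 : ¬ (π x : ℝ) < h₁ := not_lt.2 (hh.trans hx).le
  simp [layered_apply, Set.indicator, hx, h1, h2]

theorem layered_of_gt (hh : h₁ < h₂) (hx : π x < h₁) : layered h₁ h₂ π am a0 ap x = am x := by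
  have h1 : ¬ h₁ ≤ (π x : ℝ) := not_le.2 hx
  have h2 : ¬ h₂ < (π x : ℝ) := not_lt.2 (hx.trans hh).le
  simp [layered_apply, Set.indicator, hx, h1, h2]

theorem layeredConst_of_lt (hh : h₁ < h₂) (hx : h₂ < π x) :
    layeredConst G h₁ h₂ π cm c0 cp x = cp :=
  (layered_of_lt hh hx).trans (mul_one cp)

theorem layeredConst_of_gt (hh : h₁ < h₂) (hx : π x < h₁) :
    layeredConst G h₁ h₂ π cm c0 cp x = cm :=
  (layered_of_gt hh hx).trans (mul_one cm)

end Layered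

/-! ### Essential spectrum from sequences along which the potential becomes constant. -/

section Limit

variable {G : Type*} [AddCommGroup G] {ι : Type*} [Fintype ι]

theorem mem_essSpectrum_of_tendsto_const {E : ι → G} (hE : IsFolner E) (σ : G →+ ℤ)
    (hσ : ∀ j, σ (E j) = 1) {Φ : ℓ^∞(G, ℝ)} {h : ℕ → G} {c z : ℝ}
    (hh : Tendsto h atTop cofinite) (hΦ : ∀ x, Tendsto (fun k => Φ (x + h k)) atTop (𝓝 c))
    (hz : z ∈ Icc c (c + 4 * Fintype.card ι)) : (z : ℂ) ∈ essSpectrum (schr E Φ) := by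
  refine mem_essSpectrum_of_isLimitOperator fun ε hε => ?_
  obtain ⟨f, hf, hfε⟩ := exists_approx_eigenvector_lap hE σ hσ (s := z - c)
    ⟨by linarith [hz.1], by linarith [hz.2]⟩ hε
  have hc : ∀ x, (c • 1 : ℓ^∞(G, ℝ)) x = c := fun x => mul_one c
  refine ⟨h, schr E (c • 1), isLimitOperator_schr E hh fun x => ?_, f, hf, ?_⟩
  · rw [hc]; exact hΦ x
  · convert hfε using 2
    ext x
    simp only [sub_smul_id_apply, sub_eval, smul_eval, schr_apply, hc]
    push_cast
    ring

end Limit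

/-! ### Spectrum of a Jacobi operator whose potential is constant near each end. -/

section Jacobi

variable {φ : ℓ^∞(ℤ, ℝ)} {cm cp : ℝ} {K : ℤ}

/-- The two halves of `u` see constant potentials, and their images under the operator have disjoint
supports, so the two lower bounds combine. As the operator hops by one site, the margin `K + 1`
keeps the images disjoint even for `K = 0`. -/
theorem le_norm_jacobi (hK : 0 ≤ K) (hp : ∀ t, K < t → φ t = cp) (hm : ∀ t, t < -K → φ t = cm)
    {μ r : ℝ} (hrp : r ≤ |μ - cp - 2| - 2) (hrm : r ≤ |μ - cm - 2| - 2) {u : ℓ^2(ℤ, ℂ)}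
    (hu : ∀ t ∈ Icc (-(K + 1)) (K + 1), u t = 0) :
    r * ‖u‖ ≤ ‖(jacobi φ - (μ : ℂ) • ContinuousLinearMap.id ℂ ℓ^2(ℤ, ℂ)) u‖ := by
  rcases lt_or_ge r 0 with hr | hr
  · exact (mul_nonpos_of_nonpos_of_nonneg hr.le (norm_nonneg _)).trans (norm_nonneg _)
  rw [jacobi_eq]
  set T := schr (fun _ : Unit => (1 : ℤ)) φ - (μ : ℂ) • ContinuousLinearMap.id ℂ ℓ^2(ℤ, ℂ) with hT
  have hTx : ∀ w t, T w t = (2 * w t - w (t - 1) - w (t + 1)) + φ t * w t - μ * w t := fun w t => by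
    rw [hT, sub_smul_id_apply, sub_eval, smul_eval, schr_apply, lap_apply]
    simp
  set p := trunc (Ioi (0 : ℤ)) u with hpdef
  set q := trunc (Iic (0 : ℤ)) u with hqdef
  have hp0 : ∀ t, t ≤ K + 1 → p t = 0 := fun t ht => by
    by_cases h : t ∈ Ioi 0
    · rw [hpdef, trunc_apply_of_mem h]
      have h' : 0 < t := h
      exact hu t ⟨by omega, ht⟩
    · exact trunc_apply_of_notMem h u
  have hq0 : ∀ t, -(K + 1) ≤ t → q t = 0 := fun t ht => by
    by_cases h : t ∈ Iic 0
    · rw [hqdef, trunc_apply_of_mem h]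
      have h' : t ≤ 0 := h
      exact hu t ⟨ht, by omega⟩
    · exact trunc_apply_of_notMem h u
  have hpq : u = p + q := by
    ext t
    rw [add_eval]
    rcases lt_or_ge 0 t with h | h
    · rw [hq0 t (by omega), add_zero, hpdef, trunc_apply_of_mem (mem_Ioi.2 h)]
    · rw [hp0 t (by omega), zero_add, hqdef, trunc_apply_of_mem (mem_Iic.2 h)]
  have h1 : ‖u‖ ^ 2 = ‖p‖ ^ 2 + ‖q‖ ^ 2 := by
    conv_lhs => rw [hpq]
    refine norm_add_sq_of_disjoint fun t => ?_
    rcases le_or_gt 0 t with h | h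
    · exact Or.inr (hq0 t (by omega))
    · exact Or.inl (hp0 t (by omega))
  have h2 : ‖T u‖ ^ 2 = ‖T p‖ ^ 2 + ‖T q‖ ^ 2 := by
    conv_lhs => rw [hpq, map_add]
    refine norm_add_sq_of_disjoint fun t => ?_
    rw [hTx, hTx]
    rcases le_or_gt 0 t with h | h
    · refine Or.inr ?_
      rw [hq0 t (by omega), hq0 (t - 1) (by omega), hq0 (t + 1) (by omega)]
      simp
    · refine Or.inl ?_
      rw [hp0 t (by omega), hp0 (t - 1) (by omega), hp0 (t + 1) (by omega)]
      simp
  have h3 : r * ‖p‖ ≤ ‖T p‖ := by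
    refine le_norm_schr_of_const _ (c := cp) (fun t ht => hp t ?_) (by simpa using hrp)
    by_contra h
    exact ht (hp0 t (by omega))
  have h4 : r * ‖q‖ ≤ ‖T q‖ := by
    refine le_norm_schr_of_const _ (c := cm) (fun t ht => hm t ?_) (by simpa using hrm)
    by_contra h
    exact ht (hq0 t (by omega))
  refine le_of_sq_le_sq ?_ (norm_nonneg _)
  rw [h2, mul_pow, h1, mul_add, ← mul_pow, ← mul_pow]
  gcongr

theorem lt_abs_sub_of_notMem_Icc {z c a : ℝ} (h : z ∉ Icc c (c + 2 * a)) : a < |z - c - a| := by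
  rw [mem_Icc, not_and_or, not_le, not_le] at h
  rw [lt_abs]
  rcases h with h | h
  · right; linarith
  · left; linarith

theorem isSelfAdjoint_jacobi (φ : ℓ^∞(ℤ, ℝ)) : IsSelfAdjoint (jacobi φ) := by
  rw [jacobi_eq]
  exact isSelfAdjoint_schr _ _

/-- Away from both bands the operator is bounded below off a finite set of sites, hence Fredholm.
Shifting to either end of the line realizes the corresponding band. -/
theorem essSpectrum_jacobi (hK : 0 ≤ K) (hp : ∀ t, K < t → φ t = cp)
    (hm : ∀ t, t < -K → φ t = cm) :
    essSpectrum (jacobi φ) = Complex.ofReal '' (Icc cp (cp + 4) ∪ Icc cm (cm + 4)) := by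
  refine Subset.antisymm (fun z hz => ?_) ?_
  · obtain ⟨x, rfl⟩ : ∃ x : ℝ, z = x :=
      ⟨z.re, spectrum_eq_ofReal_re (isSelfAdjoint_jacobi φ) (essSpectrum_subset_spectrum _ hz)⟩
    refine ⟨x, ?_, rfl⟩
    by_contra h
    rw [mem_union, not_or] at h
    have h1 := lt_abs_sub_of_notMem_Icc (z := x) (c := cp) (a := 2) (by norm_num; simpa using h.1)
    have h2 := lt_abs_sub_of_notMem_Icc (z := x) (c := cm) (a := 2) (by norm_num; simpa using h.2)
    refine hz (isFredholm_of_le_norm (isSelfAdjoint_sub_real_smul_id (isSelfAdjoint_jacobi φ) x)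
      (evalOn (Finset.Icc (-(K + 1)) (K + 1)))
      (lt_min (sub_pos.2 h1) (sub_pos.2 h2)) fun u hu => ?_)
    refine le_norm_jacobi hK hp hm (min_le_left _ _) (min_le_right _ _) fun t ht => ?_
    exact congrFun hu ⟨t, Finset.mem_Icc.2 ht⟩
  · rintro _ ⟨x, hx, rfl⟩
    have hcast : Tendsto (fun k : ℕ => (k : ℤ)) atTop cofinite := by
      rw [← Nat.cofinite_eq_atTop]
      exact Nat.cast_injective.tendsto_cofinite
    rw [jacobi_eq]
    rcases hx with hx | hx
    · refine mem_essSpectrum_of_tendsto_const isFolner_one (AddMonoidHom.id ℤ) (fun _ => rfl)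
        hcast (fun t => tendsto_const_nhds.congr' ?_) (by simpa using hx)
      filter_upwards [eventually_gt_atTop (K - t).toNat] with k hk
      exact (hp _ (by omega)).symm
    · refine mem_essSpectrum_of_tendsto_const isFolner_one (AddMonoidHom.id ℤ) (fun _ => rfl)
        (h := fun k : ℕ => -(k : ℤ)) (neg_injective.tendsto_cofinite.comp hcast)
        (fun t => tendsto_const_nhds.congr' ?_) (by simpa using hx)
      filter_upwards [eventually_gt_atTop (t + K).toNat] with k hk
      exact (hm _ (by omega)).symm

/-- The essential spectrum is a union of nondegenerate intervals, so none of its points is isolated.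
-/
theorem disjoint_essSpectrum_discreteSpectrum_jacobi (hK : 0 ≤ K) (hp : ∀ t, K < t → φ t = cp)
    (hm : ∀ t, t < -K → φ t = cm) :
    Disjoint (essSpectrum (jacobi φ)) (discreteSpectrum (jacobi φ)) := by
  rw [Set.disjoint_left]
  intro z hz hd
  obtain ⟨ε, hε, hiso⟩ := hd.2.2
  have hess := essSpectrum_jacobi hK hp hm
  have key : ∀ c x : ℝ, x ∈ Icc c (c + 4) → ∃ y ∈ Icc c (c + 4), |y - x| < ε ∧ y ≠ x := by
    intro c x hx
    rcases lt_or_ge x (c + 4) with h | h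
    · have h1 : 0 < min (ε / 2) (c + 4 - x) := lt_min (by positivity) (by linarith)
      have h2 := min_le_left (ε / 2) (c + 4 - x)
      have h3 := min_le_right (ε / 2) (c + 4 - x)
      refine ⟨x + min (ε / 2) (c + 4 - x), ⟨by linarith [hx.1], by linarith⟩, ?_, by linarith⟩
      rw [add_sub_cancel_left, abs_of_pos h1]
      linarith
    · have h1 : 0 < min (ε / 2) 4 := lt_min (by positivity) (by norm_num)
      have h2 := min_le_left (ε / 2) 4
      have h3 := min_le_right (ε / 2) 4
      refine ⟨x - min (ε / 2) 4, ⟨by linarith, by linarith [hx.2]⟩, ?_, by linarith⟩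
      rw [sub_sub_cancel_left, abs_neg, abs_of_pos h1]
      linarith
  rw [hess] at hz
  obtain ⟨x, hx, rfl⟩ := hz
  obtain ⟨y, hy, hyx, hne⟩ : ∃ y ∈ Icc cp (cp + 4) ∪ Icc cm (cm + 4), |y - x| < ε ∧ y ≠ x := by
    rcases hx with hx | hx
    · obtain ⟨y, hy, h⟩ := key _ _ hx
      exact ⟨y, Or.inl hy, h⟩
    · obtain ⟨y, hy, h⟩ := key _ _ hx
      exact ⟨y, Or.inr hy, h⟩
  refine hne (Complex.ofReal_injective (hiso y (essSpectrum_subset_spectrum _ ?_) ?_))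
  · rw [hess]; exact ⟨y, hy, rfl⟩
  · rwa [dist_eq_norm, ← Complex.ofReal_sub, Complex.norm_real]

/-- Off the bands lie a lower ray, an upper ray and possibly a gap. Each, with the rays cut beyond
the norm bound, is covered by an interval whose radius `le_norm_jacobi` attains in full, so
eigenvalues cannot accumulate even at band edges. -/
theorem finite_discreteSpectrum_jacobi (hK : 0 ≤ K) (hp : ∀ t, K < t → φ t = cp)
    (hm : ∀ t, t < -K → φ t = cm) : (discreteSpectrum (jacobi φ)).Finite := by
  have hfin : ∀ μ r : ℝ, r ≤ |μ - cp - 2| - 2 → r ≤ |μ - cm - 2| - 2 →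
      {z : ℂ | Module.End.HasEigenvalue (jacobi φ : ℓ^2(ℤ, ℂ) →ₗ[ℂ] ℓ^2(ℤ, ℂ)) z ∧
        |z.re - μ| < r}.Finite := fun μ r h1 h2 =>
    finite_eigenvalues_of_le_norm (isSelfAdjoint_jacobi φ)
      (evalOn (Finset.Icc (-(K + 1)) (K + 1))).toLinearMap fun u hu =>
        le_norm_jacobi hK hp hm h1 h2 fun t ht => congrFun hu ⟨t, Finset.mem_Icc.2 ht⟩
  set m := min cp cm with hmdef
  set M := max cp cm with hMdef
  have hc : ∀ P : ℝ → Prop, P m → P M → P cp ∧ P cm := by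
    intro P h1 h2
    rcases le_total cp cm with h | h
    · rw [hmdef, min_eq_left h] at h1; rw [hMdef, max_eq_right h] at h2; exact ⟨h1, h2⟩
    · rw [hmdef, min_eq_right h] at h1; rw [hMdef, max_eq_left h] at h2; exact ⟨h2, h1⟩
  have hmM : m ≤ M := min_le_max
  set b := ‖jacobi φ‖ * ‖(1 : ℓ^2(ℤ, ℂ) →L[ℂ] ℓ^2(ℤ, ℂ))‖ with hbdef
  set B := b + |m| + |M| + 4 with hB
  have hB0 : 0 ≤ B := by positivity
  have h1 := hc (fun c => B ≤ |(m - B) - c - 2| - 2)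
    (by rw [abs_of_nonpos (by linarith)]; linarith) (by rw [abs_of_nonpos (by linarith)]; linarith)
  have h2 := hc (fun c => B ≤ |(M + 4 + B) - c - 2| - 2)
    (by rw [abs_of_nonneg (by linarith)]; linarith) (by rw [abs_of_nonneg (by linarith)]; linarith)
  -- Centre and radius of the gap `(m + 4, M)`; if the bands overlap the radius is not positive and
  -- the set is empty.
  have h3 := hc (fun c => (M - m - 4) / 2 ≤ |(M + m + 4) / 2 - c - 2| - 2)
    (by rw [abs_of_nonneg (by linarith)]; linarith) (by rw [abs_of_nonpos (by linarith)]; linarith)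
  refine ((hfin _ _ h1.1 h1.2).union ((hfin _ _ h2.1 h2.2).union (hfin _ _ h3.1 h3.2))).subset ?_
  intro z hz
  have hzs := discreteSpectrum_subset_spectrum _ hz
  have hzr := spectrum_eq_ofReal_re (isSelfAdjoint_jacobi φ) hzs
  have hzB : |z.re| ≤ b := (Complex.abs_re_le_norm z).trans
    (spectrum.norm_le_norm_mul_of_mem hzs)
  have hzess : z ∉ essSpectrum (jacobi φ) :=
    Set.disjoint_right.1 (disjoint_essSpectrum_discreteSpectrum_jacobi hK hp hm) hz
  rw [essSpectrum_jacobi hK hp hm] at hzess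
  have hz4 : ∀ c, c = cp ∨ c = cm → z.re < c ∨ c + 4 < z.re := by
    intro c hcc
    by_contra! hcon
    refine hzess ⟨z.re, ?_, hzr.symm⟩
    rcases hcc with rfl | rfl
    · exact Or.inl hcon
    · exact Or.inr hcon
  have hzm := hz4 m (min_choice _ _)
  have hzM := hz4 M (max_choice _ _)
  have hzb := abs_le.1 hzB
  have hm' := abs_le.1 (le_refl |m|)
  have hM' := abs_le.1 (le_refl |M|)
  rcases hzm with h | h
  · exact Or.inl ⟨hz.1, abs_lt.2 ⟨by linarith, by linarith⟩⟩
  · rcases hzM with h' | h'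
    · exact Or.inr (Or.inr ⟨hz.1, abs_lt.2 ⟨by linarith, by linarith⟩⟩)
    · exact Or.inr (Or.inl ⟨hz.1, abs_lt.2 ⟨by linarith, by linarith⟩⟩)

end Jacobi

/-! ### Separation of the last variable. -/

section Fiber

variable {n : ℕ}

theorem tsum_snoc (f : (Fin (n + 1) → ℤ) → ℝ≥0∞) :
    ∑' x, f x = ∑' (y : Fin n → ℤ) (t : ℤ), f (Fin.snoc (α := fun _ => ℤ) y t) := by
  rw [← (Fin.snocEquiv fun _ : Fin (n + 1) => ℤ).tsum_eq, ENNReal.tsum_prod', ENNReal.tsum_comm]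
  rfl

theorem snoc_sub_single_last (y : Fin n → ℤ) (t s : ℤ) :
    (Fin.snoc (α := fun _ => ℤ) y t : Fin (n + 1) → ℤ) - Pi.single (Fin.last n) s
      = Fin.snoc (α := fun _ => ℤ) y (t - s) := by
  ext i
  refine Fin.lastCases ?_ (fun j => ?_) i
  · simp
  · simp

theorem snoc_sub_single_castSucc (y : Fin n → ℤ) (t s : ℤ) (k : Fin n) :
    (Fin.snoc (α := fun _ => ℤ) y t : Fin (n + 1) → ℤ) - Pi.single k.castSucc s
      = Fin.snoc (α := fun _ => ℤ) (y - Pi.single k s) t := by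
  ext i
  refine Fin.lastCases ?_ (fun j => ?_) i
  · simp
  · by_cases h : j = k
    · subst h; simp
    · simp [Pi.single_eq_of_ne h, Pi.single_eq_of_ne (fun h' => h (Fin.castSucc_injective _ h'))]

theorem snoc_add_single_last (y : Fin n → ℤ) (t s : ℤ) :
    (Fin.snoc (α := fun _ => ℤ) y t : Fin (n + 1) → ℤ) + Pi.single (Fin.last n) s
      = Fin.snoc (α := fun _ => ℤ) y (t + s) := by
  have := snoc_sub_single_last y t (-s)
  rwa [Pi.single_neg, sub_neg_eq_add, sub_neg_eq_add] at this

theorem snoc_add_single_castSucc (y : Fin n → ℤ) (t s : ℤ) (k : Fin n) :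
    (Fin.snoc (α := fun _ => ℤ) y t : Fin (n + 1) → ℤ) + Pi.single k.castSucc s
      = Fin.snoc (α := fun _ => ℤ) (y + Pi.single k s) t := by
  have := snoc_sub_single_castSucc y t (-s) k
  rwa [Pi.single_neg, Pi.single_neg, sub_neg_eq_add, sub_neg_eq_add] at this

theorem snoc_left_injective (y : Fin n → ℤ) :
    Function.Injective fun t : ℤ => (Fin.snoc (α := fun _ => ℤ) y t : Fin (n + 1) → ℤ) := by
  intro t s h
  have := congrFun h (Fin.last n)
  simpa using this

/-- The restriction of `u` to the line through `y` in the direction of the last coordinate. -/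
def fiber (u : ℓ^2(Fin (n + 1) → ℤ, ℂ)) (y : Fin n → ℤ) : ℓ^2(ℤ, ℂ) :=
  ⟨fun t => u (Fin.snoc (α := fun _ => ℤ) y t), memℓp_gen
    (((lp.memℓp u).summable (by norm_num)).comp_injective (snoc_left_injective y))⟩

theorem fiber_apply (u : ℓ^2(Fin (n + 1) → ℤ, ℂ)) (y : Fin n → ℤ) (t : ℤ) :
    fiber u y t = u (Fin.snoc (α := fun _ => ℤ) y t) := rfl

theorem ofReal_norm_sq_eq_tsum_fiber (u : ℓ^2(Fin (n + 1) → ℤ, ℂ)) :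
    ENNReal.ofReal (‖u‖ ^ 2) = ∑' y, ENNReal.ofReal (‖fiber u y‖ ^ 2) := by
  rw [ofReal_norm_sq, tsum_snoc]
  refine tsum_congr fun y => ?_
  rw [ofReal_norm_sq]
  rfl

variable {Φ : ℓ^∞(Fin (n + 1) → ℤ, ℝ)} {φ : ℓ^∞(ℤ, ℝ)}

/-- Hopping only in the last direction, the operator is an orthogonal sum of copies of the Jacobi
operator over the lines parallel to that axis. -/
theorem le_norm_of_fiber (hΦ : ∀ x, Φ x = φ (x (Fin.last n))) {μ r : ℝ} (hr : 0 ≤ r)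
    (h : ∀ w, r * ‖w‖ ≤ ‖(jacobi φ - (μ : ℂ) • ContinuousLinearMap.id ℂ ℓ^2(ℤ, ℂ)) w‖)
    (u : ℓ^2(Fin (n + 1) → ℤ, ℂ)) :
    r * ‖u‖ ≤ ‖(schr (fun _ : Unit => Pi.single (Fin.last n) (1 : ℤ)) Φ
      - (μ : ℂ) • ContinuousLinearMap.id ℂ ℓ^2(Fin (n + 1) → ℤ, ℂ)) u‖ := by
  set T := schr (fun _ : Unit => Pi.single (Fin.last n) (1 : ℤ)) Φ
      - (μ : ℂ) • ContinuousLinearMap.id ℂ ℓ^2(Fin (n + 1) → ℤ, ℂ) with hT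
  have hfib : ∀ y, fiber (T u) y
      = (jacobi φ - (μ : ℂ) • ContinuousLinearMap.id ℂ ℓ^2(ℤ, ℂ)) (fiber u y) := fun y => by
    ext t
    rw [jacobi_eq, fiber_apply, hT, sub_smul_id_apply, sub_smul_id_apply, sub_eval, sub_eval,
      smul_eval, smul_eval, schr_apply, schr_apply, lap_apply, lap_apply, hΦ]
    simp only [fiber_apply, snoc_sub_single_last, snoc_add_single_last, Fin.snoc_last]
  refine le_of_sq_le_sq ?_ (norm_nonneg _)
  rw [mul_pow, ← ENNReal.ofReal_le_ofReal_iff (sq_nonneg _), ENNReal.ofReal_mul (sq_nonneg _),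
    ofReal_norm_sq_eq_tsum_fiber, ofReal_norm_sq_eq_tsum_fiber, ← ENNReal.tsum_mul_left]
  refine ENNReal.tsum_le_tsum fun y => ?_
  rw [hfib, ← ENNReal.ofReal_mul (sq_nonneg _), ← mul_pow]
  exact ENNReal.ofReal_le_ofReal (pow_le_pow_left₀ (by positivity) (h _) 2)

/-- Write `z = (z - 2n) + 2n`. The Jacobi part minus `z - 2n` is bounded below by some `r' > 2n`,
because the spectrum avoids the closed interval of radius `2n` about that point; the other `n`
directions minus `2n` have norm at most `2n`. -/
theorem exists_le_norm_schr_of_spectrum_jacobi (hΦ : ∀ x, Φ x = φ (x (Fin.last n))) {z : ℝ}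
    (h : ∀ x : ℝ, (x : ℂ) ∈ spectrum ℂ (jacobi φ) → x ∉ Icc (z - 4 * n) z) :
    ∃ η > 0, ∀ u : ℓ^2(Fin (n + 1) → ℤ, ℂ),
      η * ‖u‖ ≤ ‖(schr (fun j : Fin (n + 1) => Pi.single j (1 : ℤ)) Φ
        - (z : ℂ) • ContinuousLinearMap.id ℂ ℓ^2(Fin (n + 1) → ℤ, ℂ)) u‖ := by
  obtain ⟨r', hr', hle⟩ := exists_lt_le_norm (isSelfAdjoint_jacobi φ) (μ := z - 2 * n)
    (r := 2 * n) (by positivity) fun x hx => by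
      have := lt_abs_sub_of_notMem_Icc (z := x) (c := z - 4 * n) (a := 2 * n)
        (by rw [show z - 4 * n + 2 * (2 * n) = z by ring]; exact h x hx)
      convert this using 2
      ring
  have hr0 : (0 : ℝ) ≤ 2 * n := by positivity
  refine ⟨r' - 2 * n, by linarith, fun u => ?_⟩
  have h1 := le_norm_of_fiber hΦ (by linarith) hle u
  have h2 := norm_lap_sub_le (fun j : Fin n => Pi.single j.castSucc (1 : ℤ)) u
  set a := (schr (fun _ : Unit => Pi.single (Fin.last n) (1 : ℤ)) Φ
      - ((z - 2 * n : ℝ) : ℂ) • ContinuousLinearMap.id ℂ ℓ^2(Fin (n + 1) → ℤ, ℂ)) u with ha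
  set b := lap (fun j : Fin n => (Pi.single j.castSucc (1 : ℤ) : Fin (n + 1) → ℤ)) u
      - ((2 * Fintype.card (Fin n) : ℝ) : ℂ) • u with hb
  have h3 : (schr (fun j : Fin (n + 1) => Pi.single j (1 : ℤ)) Φ
        - (z : ℂ) • ContinuousLinearMap.id ℂ ℓ^2(Fin (n + 1) → ℤ, ℂ)) u = a + b := by
    ext x
    rw [ha, hb, add_eval]
    simp only [sub_smul_id_apply, sub_eval, smul_eval, schr_apply, lap_apply]
    rw [Fin.sum_univ_castSucc]
    simp only [Finset.univ_unique, Finset.sum_singleton, Fintype.card_fin]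
    push_cast
    ring
  rw [h3]
  rw [Fintype.card_fin] at h2
  have h4 := norm_sub_le_norm_add a b
  rw [sub_mul]
  linarith

/-- The function `x ↦ f(x') ψ(x_N)`. -/
def tensor (f : ℓ^2(Fin n → ℤ, ℂ)) (ψ : ℓ^2(ℤ, ℂ)) : ℓ^2(Fin (n + 1) → ℤ, ℂ) :=
  ⟨fun x => f (fun i => x i.castSucc) * ψ (x (Fin.last n)), memℓp_gen (by
    rw [← (Fin.snocEquiv fun _ : Fin (n + 1) => ℤ).summable_iff]
    have h := (hasSum_norm_sq ψ).summable.mul_of_nonneg (hasSum_norm_sq f).summable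
      (fun _ => sq_nonneg _) (fun _ => sq_nonneg _)
    refine h.congr fun p => ?_
    simp [Fin.snocEquiv, mul_pow, mul_comm])⟩

theorem tensor_apply (f : ℓ^2(Fin n → ℤ, ℂ)) (ψ : ℓ^2(ℤ, ℂ)) (x : Fin (n + 1) → ℤ) :
    tensor f ψ x = f (fun i => x i.castSucc) * ψ (x (Fin.last n)) := rfl

theorem tensor_snoc (f : ℓ^2(Fin n → ℤ, ℂ)) (ψ : ℓ^2(ℤ, ℂ)) (y : Fin n → ℤ) (t : ℤ) :
    tensor f ψ (Fin.snoc (α := fun _ => ℤ) y t) = f y * ψ t := by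
  rw [tensor_apply]; simp

theorem norm_tensor (f : ℓ^2(Fin n → ℤ, ℂ)) (ψ : ℓ^2(ℤ, ℂ)) : ‖tensor f ψ‖ = ‖f‖ * ‖ψ‖ := by
  have h : ENNReal.ofReal (‖tensor f ψ‖ ^ 2) = ENNReal.ofReal ((‖f‖ * ‖ψ‖) ^ 2) := by
    rw [mul_pow, ENNReal.ofReal_mul (sq_nonneg _), ofReal_norm_sq, tsum_snoc, ofReal_norm_sq f,
      ofReal_norm_sq ψ, ← ENNReal.tsum_mul_right]
    refine tsum_congr fun y => ?_
    rw [← ENNReal.tsum_mul_left]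
    refine tsum_congr fun t => ?_
    rw [tensor_snoc, norm_mul, mul_pow, ENNReal.ofReal_mul (sq_nonneg _)]
  rw [ENNReal.ofReal_eq_ofReal_iff (sq_nonneg _) (sq_nonneg _)] at h
  exact (pow_left_inj₀ (norm_nonneg _) (by positivity) two_ne_zero).1 h

/-- Product of an approximate plane wave at energy `s` in the first `n` variables with an exact
eigenfunction in the last: the residual stays in the first factor. -/
theorem exists_approx_eigenvector_schr (hΦ : ∀ x, Φ x = φ (x (Fin.last n))) {lam s : ℝ}
    (hlam : Module.End.HasEigenvalue (jacobi φ : ℓ^2(ℤ, ℂ) →ₗ[ℂ] ℓ^2(ℤ, ℂ)) (lam : ℂ))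
    (hs : s ∈ Icc 0 (4 * (n : ℝ))) {ε : ℝ} (hε : 0 < ε) :
    ∃ u : ℓ^2(Fin (n + 1) → ℤ, ℂ), u ≠ 0 ∧
      ‖(schr (fun j : Fin (n + 1) => Pi.single j (1 : ℤ)) Φ - ((lam + s : ℝ) : ℂ) •
        ContinuousLinearMap.id ℂ ℓ^2(Fin (n + 1) → ℤ, ℂ)) u‖ ≤ ε * ‖u‖ := by
  obtain ⟨f, hf, hfε⟩ := exists_approx_eigenvector_lap (isFolner_single n)
    (∑ i, Pi.evalAddMonoidHom (fun _ : Fin n => ℤ) i) (fun j => by simp) (s := s)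
    (by simpa using hs) hε
  obtain ⟨ψ, hψ⟩ := hlam.exists_hasEigenvector
  have hψe : ∀ t, 2 * ψ t - ψ (t - 1) - ψ (t + 1) + φ t * ψ t = lam * ψ t := fun t => by
    have h1 : jacobi φ ψ = (lam : ℂ) • ψ := hψ.apply_eq_smul
    have h2 := congrArg (fun w : ℓ^2(ℤ, ℂ) => w t) h1
    simp only [jacobi_eq, schr_apply, lap_apply, smul_eval] at h2
    simpa using h2
  refine ⟨tensor f ψ, ?_, ?_⟩
  · rw [← norm_pos_iff, norm_tensor]
    exact mul_pos (norm_pos_iff.2 hf) (norm_pos_iff.2 hψ.2)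
  · have h1 : (schr (fun j : Fin (n + 1) => Pi.single j (1 : ℤ)) Φ - ((lam + s : ℝ) : ℂ) •
        ContinuousLinearMap.id ℂ ℓ^2(Fin (n + 1) → ℤ, ℂ)) (tensor f ψ)
        = tensor (lap (fun j : Fin n => Pi.single j (1 : ℤ)) f - (s : ℂ) • f) ψ := by
      ext x
      obtain ⟨⟨t, y⟩, rfl⟩ := (Fin.snocEquiv fun _ : Fin (n + 1) => ℤ).surjective x
      change _ = tensor _ ψ (Fin.snoc (α := fun _ => ℤ) y t)
      change (_ : ℓ^2(Fin (n + 1) → ℤ, ℂ)) (Fin.snoc (α := fun _ => ℤ) y t) = _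
      rw [tensor_snoc]
      simp only [sub_smul_id_apply, sub_eval, smul_eval, schr_apply, lap_apply, hΦ]
      rw [Fin.sum_univ_castSucc]
      simp only [snoc_sub_single_last, snoc_add_single_last, snoc_sub_single_castSucc,
        snoc_add_single_castSucc, tensor_snoc, Fin.snoc_last]
      have h2 : ∀ j : Fin n, 2 * (f y * ψ t) - f (y - Pi.single j 1) * ψ t
          - f (y + Pi.single j 1) * ψ t
          = (2 * f y - f (y - Pi.single j 1) - f (y + Pi.single j 1)) * ψ t := fun j => by ring
      simp only [h2, ← Finset.sum_mul]
      push_cast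
      linear_combination f y * hψe t
    rw [h1, norm_tensor, norm_tensor, ← mul_assoc]
    gcongr

end Fiber

/-! ### Slowly oscillating functions on half spaces. -/

section SlowOsc

variable {n : ℕ}

/-- Discrete half spaces are connected. -/
theorem halfSpace_induction {σ K : ℤ} (hσ : σ = 1 ∨ σ = -1) {P : (Fin (n + 1) → ℤ) → Prop}
    (hstep : ∀ (x : Fin (n + 1) → ℤ) (j : Fin (n + 1)) (e : ℤ), (e = 1 ∨ e = -1) → K ≤ σ * x (Fin.last n) → P x →
      K ≤ σ * (x + Pi.single j e : Fin (n + 1) → ℤ) (Fin.last n) → P (x + Pi.single j e))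
    {x y : Fin (n + 1) → ℤ} (hx : K ≤ σ * x (Fin.last n)) (hy : K ≤ σ * y (Fin.last n))
    (hPx : P x) : P y := by
  -- One coordinate moves towards its target by unit steps. The last coordinate then stays between
  -- two admissible values, so the path never leaves the half space.
  have hupd : ∀ (j : Fin (n + 1)) (k : ℕ) (x : Fin (n + 1) → ℤ) (t : ℤ), (t - x j).natAbs = k →
      K ≤ σ * x (Fin.last n) → K ≤ σ * (Function.update x j t) (Fin.last n) → P x →
      P (Function.update x j t) := by
    intro j k
    induction k with
    | zero =>
      intro x t ht _ _ hP
      have : t = x j := by omega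
      rwa [this, Function.update_eq_self]
    | succ k ih =>
      intro x t ht hx hxt hP
      obtain ⟨e, he, hk⟩ : ∃ e : ℤ, (e = 1 ∨ e = -1) ∧ (t - e - x j).natAbs = k := by
        rcases lt_or_ge (x j) t with h | h
        · exact ⟨1, Or.inl rfl, by omega⟩
        · exact ⟨-1, Or.inr rfl, by omega⟩
      have hadd : Function.update x j t = Function.update x j (t - e) + Pi.single j e := by
        ext i
        by_cases hi : i = j
        · subst hi; simp
        · simp [hi]
      have hmid : K ≤ σ * (Function.update x j (t - e)) (Fin.last n) := by
        by_cases hj : Fin.last n = j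
        · subst hj
          rw [Function.update_self] at hxt ⊢
          rcases hσ with rfl | rfl <;> rcases he with rfl | rfl <;> omega
        · rwa [Function.update_of_ne hj]
      have h1 := ih x (t - e) hk hx hmid hP
      rw [hadd] at hxt ⊢
      exact hstep _ j e he hmid h1 hxt
  have hpw : ∀ s : Finset (Fin (n + 1)), K ≤ σ * (s.piecewise y x) (Fin.last n) := fun s => by
    by_cases h : Fin.last n ∈ s
    · rwa [Finset.piecewise_eq_of_mem _ _ _ h]
    · rwa [Finset.piecewise_eq_of_notMem _ _ _ h]
  have hall : ∀ s : Finset (Fin (n + 1)), P (s.piecewise y x) := by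
    intro s
    induction s using Finset.induction_on with
    | empty => simpa using hPx
    | insert j s hj ih =>
      have h1 := hpw (insert j s)
      rw [Finset.piecewise_insert] at h1 ⊢
      exact hupd j _ _ _ rfl (hpw s) h1 ih
  simpa using hall Finset.univ

theorem isBoundedUnder_le_lp {G : Type*} (Φ : ℓ^∞(G, ℝ)) (F : Filter G) :
    F.IsBoundedUnder (· ≤ ·) Φ :=
  isBoundedUnder_of ⟨‖Φ‖, fun x => (le_abs_self _).trans (lp.norm_apply_le_norm (by simp) Φ x)⟩

theorem isBoundedUnder_ge_lp {G : Type*} (Φ : ℓ^∞(G, ℝ)) (F : Filter G) :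
    F.IsBoundedUnder (· ≥ ·) Φ :=
  isBoundedUnder_of ⟨-‖Φ‖, fun x =>
    neg_le_of_abs_le (lp.norm_apply_le_norm (by simp) Φ x)⟩

theorem eventually_liminf_limsup {G : Type*} (Φ : ℓ^∞(G, ℝ)) (F : Filter G) {ε : ℝ} (hε : 0 < ε) :
    ∀ᶠ x in F, liminf Φ F - ε < Φ x ∧ Φ x < limsup Φ F + ε :=
  (eventually_lt_of_lt_liminf (sub_lt_self _ hε) (isBoundedUnder_ge_lp Φ F)).and
    (eventually_lt_of_limsup_lt (lt_add_of_pos_right _ hε) (isBoundedUnder_le_lp Φ F))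

theorem mem_Icc_liminf_limsup {G : Type*} (Φ : ℓ^∞(G, ℝ)) {F : Filter G} {h : ℕ → G} {c : ℝ}
    (hh : Tendsto h atTop F) (hc : Tendsto (fun k => Φ (h k)) atTop (𝓝 c)) :
    c ∈ Icc (liminf Φ F) (limsup Φ F) := by
  constructor
  · refine le_of_forall_pos_sub_le fun ε hε => ?_
    exact ge_of_tendsto hc ((hh.eventually (eventually_liminf_limsup Φ F hε)).mono
      fun k hk => hk.1.le)
  · refine le_of_forall_pos_le_add fun ε hε => ?_
    exact le_of_tendsto hc ((hh.eventually (eventually_liminf_limsup Φ F hε)).mono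
      fun k hk => hk.2.le)

theorem SlowlyOscillating.eventually_abs_lt {G : Type*} [AddCommGroup G] {Φ : ℓ^∞(G, ℝ)}
    (hΦ : SlowlyOscillating Φ) (y : G) {ε : ℝ} (hε : 0 < ε) :
    ∀ᶠ x in cofinite, |Φ (x + y) - Φ x| < ε := by
  have := (Metric.tendsto_nhds.1 (hΦ y)) ε hε
  simpa using this

theorem SlowlyOscillating.tendsto_add {G : Type*} [AddCommGroup G] {Φ : ℓ^∞(G, ℝ)}
    (hΦ : SlowlyOscillating Φ) {h : ℕ → G} {c : ℝ} (hh : Tendsto h atTop cofinite)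
    (hc : Tendsto (fun k => Φ (h k)) atTop (𝓝 c)) (x : G) :
    Tendsto (fun k => Φ (x + h k)) atTop (𝓝 c) := by
  have h1 := ((hΦ x).comp hh).add hc
  rw [zero_add] at h1
  refine h1.congr fun k => ?_
  simp [add_comm]

/-- Discrete intermediate value theorem. Deep in the half space each unit step changes `Φ` by less
than `ε`, so `Φ` cannot jump across `(c - ε, c + ε)`. Values near the liminf and the limsup may
occur only close to the hyperplane, but translating such far points by the fixed depth `L` hardly
changes `Φ`. -/
theorem SlowlyOscillating.exists_abs_sub_lt {Φ : ℓ^∞(Fin (n + 1) → ℤ, ℝ)}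
    (hΦ : SlowlyOscillating Φ) {σ : ℤ} (hσ : σ = 1 ∨ σ = -1) {F : Filter (Fin (n + 1) → ℤ)}
    [F.NeBot] (hF : F ≤ cofinite) (hFσ : ∀ᶠ x in F, 0 ≤ σ * x (Fin.last n)) {c : ℝ}
    (hc : c ∈ Icc (liminf Φ F) (limsup Φ F)) {ε : ℝ} (hε : 0 < ε) (K : ℤ) :
    ∃ x : Fin (n + 1) → ℤ, K ≤ σ * x (Fin.last n) ∧ |Φ x - c| < ε := by
  have hσσ : σ * σ = 1 := by rcases hσ with rfl | rfl <;> rfl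
  have hev : ∀ᶠ x in cofinite, ∀ j : Fin (n + 1), ∀ e ∈ ({1, -1} : Finset ℤ),
      |Φ (x + Pi.single j e) - Φ x| < ε := by
    rw [eventually_all]
    intro j
    rw [Finset.eventually_all]
    intro e _
    exact hΦ.eventually_abs_lt _ hε
  rw [eventually_cofinite] at hev
  obtain ⟨B, hB⟩ := (hev.image fun x => σ * x (Fin.last n)).bddAbove
  set L := max K (B + 1) with hL
  have hLstep : ∀ x : Fin (n + 1) → ℤ, L ≤ σ * x (Fin.last n) → ∀ j e, (e = 1 ∨ e = -1) →
      |Φ (x + Pi.single j e) - Φ x| < ε := by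
    intro x hx j e he
    by_contra hcon
    have h1 := hB (mem_image_of_mem (fun x : Fin (n + 1) → ℤ => σ * x (Fin.last n))
      (show x ∈ _ from fun h => hcon (h j e (by simpa using he))))
    have h2 : B + 1 ≤ L := le_max_right _ _
    change σ * x (Fin.last n) ≤ B at h1
    omega
  have hshift : ∀ᶠ x in F, |Φ (x + Pi.single (Fin.last n) (σ * L)) - Φ x| < ε / 2 :=
    hF (hΦ.eventually_abs_lt _ (by positivity))
  have hmem : ∀ x : Fin (n + 1) → ℤ, 0 ≤ σ * x (Fin.last n) →
      L ≤ σ * (x + Pi.single (Fin.last n) (σ * L) : Fin (n + 1) → ℤ) (Fin.last n) := by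
    intro x hx
    rw [Pi.add_apply, Pi.single_eq_same, mul_add, ← mul_assoc, hσσ]
    omega
  by_contra! hcon
  have hcon' : ∀ x : Fin (n + 1) → ℤ, L ≤ σ * x (Fin.last n) → ε ≤ |Φ x - c| := fun x hx =>
    hcon x ((le_max_left _ _).trans hx)
  obtain ⟨x, hx, hx0, hxs⟩ := ((frequently_lt_of_liminf_lt
    (isBoundedUnder_le_lp Φ F).isCoboundedUnder_ge
    (lt_of_le_of_lt hc.1 (lt_add_of_pos_right c (half_pos hε)))).and_eventually
      (hFσ.and hshift)).exists
  obtain ⟨y, hy, hy0, hys⟩ := ((frequently_lt_of_lt_limsup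
    (isBoundedUnder_ge_lp Φ F).isCoboundedUnder_le
    (lt_of_lt_of_le (sub_lt_self c (half_pos hε)) hc.2)).and_eventually
      (hFσ.and hshift)).exists
  have h1 : Φ (x + Pi.single (Fin.last n) (σ * L)) ≤ c - ε := by
    have := hcon' _ (hmem x hx0)
    rw [abs_lt] at hxs
    rcases le_abs.1 this with h | h <;> linarith
  have h2 : c + ε ≤ Φ (y + Pi.single (Fin.last n) (σ * L)) := by
    have := hcon' _ (hmem y hy0)
    rw [abs_lt] at hys
    rcases le_abs.1 this with h | h <;> linarith
  have h3 : Φ (y + Pi.single (Fin.last n) (σ * L)) ≤ c - ε := by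
    refine halfSpace_induction hσ (P := fun x => Φ x ≤ c - ε) (fun x j e he hx hP hx' => ?_)
      (hmem x hx0) (hmem y hy0) h1
    have h4 := abs_lt.1 (hLstep x hx j e he)
    rcases le_abs.1 (hcon' _ hx') with h | h <;> linarith
  linarith

/-- The interval is the union of the bands `[c, c + 4N]` over all `c` between liminf and limsup.
Each such `c` is a limit of `Φ` at points whose depth tends to infinity, where `Ψ` agrees with `Φ`.
-/
theorem mem_essSpectrum_of_mem_Icc_liminf {Φ Ψ : ℓ^∞(Fin (n + 1) → ℤ, ℝ)}
    (hΦ : SlowlyOscillating Φ) {σ : ℤ} (hσ : σ = 1 ∨ σ = -1) {F : Filter (Fin (n + 1) → ℤ)}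
    [F.NeBot] (hF : F ≤ cofinite) (hFσ : ∀ᶠ x in F, 0 ≤ σ * x (Fin.last n)) {K : ℤ}
    (hΨ : ∀ x, K ≤ σ * x (Fin.last n) → Ψ x = Φ x) {z : ℝ}
    (hz : z ∈ Icc (liminf Φ F) (limsup Φ F + 4 * (n + 1))) :
    (z : ℂ) ∈ essSpectrum (schr (fun j : Fin (n + 1) => Pi.single j (1 : ℤ)) Ψ) := by
  obtain ⟨c, hc, hzc⟩ : ∃ c ∈ Icc (liminf Φ F) (limsup Φ F), z ∈ Icc c (c + 4 * (n + 1)) := by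
    have hle : liminf Φ F ≤ limsup Φ F :=
      liminf_le_limsup (isBoundedUnder_le_lp Φ F) (isBoundedUnder_ge_lp Φ F)
    have hn : (0 : ℝ) ≤ 4 * (n + 1) := by positivity
    rcases le_total z (limsup Φ F) with h | h
    · exact ⟨z, ⟨hz.1, h⟩, le_rfl, by linarith⟩
    · exact ⟨limsup Φ F, ⟨hle, le_rfl⟩, h, hz.2⟩
  choose h hhK hhc using fun k : ℕ =>
    hΦ.exists_abs_sub_lt hσ hF hFσ hc (ε := 1 / ((k : ℝ) + 1)) (by positivity) (k : ℤ)
  have hev : ∀ x : Fin (n + 1) → ℤ, ∀ L : ℤ, ∀ᶠ k in atTop, L ≤ σ * (x + h k) (Fin.last n) := by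
    intro x L
    filter_upwards [eventually_ge_atTop (L - σ * x (Fin.last n)).toNat] with k hk
    have := hhK k
    rw [Pi.add_apply, mul_add]
    omega
  have hcof : Tendsto h atTop cofinite := by
    refine hasBasis_cofinite.tendsto_right_iff.2 fun S hS => ?_
    have h1 : ∀ᶠ k in atTop, ∀ x ∈ S, h k ≠ x := by
      rw [eventually_all_finite hS]
      intro x _
      filter_upwards [hev 0 (σ * x (Fin.last n) + 1)] with k hk he
      rw [zero_add, he] at hk
      omega
    filter_upwards [h1] with k hk hS
    exact hk _ hS rfl
  have hlim : Tendsto (fun k => Φ (h k)) atTop (𝓝 c) := by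
    rw [tendsto_iff_dist_tendsto_zero]
    exact squeeze_zero (fun _ => dist_nonneg) (fun k => (hhc k).le)
      tendsto_one_div_add_atTop_nhds_zero_nat
  refine mem_essSpectrum_of_tendsto_const (isFolner_single (n + 1))
    (∑ i, Pi.evalAddMonoidHom (fun _ : Fin (n + 1) => ℤ) i) (fun j => by simp) hcof
    (fun x => ?_) (c := c) (by simpa using hzc)
  refine (hΦ.tendsto_add hcof hlim x).congr' ?_
  filter_upwards [hev x K] with k hk
  exact (hΨ _ hk).symm

instance upper_neBot (n : ℕ) : (upper n).NeBot := by
  rw [upper, cofinite_inf_principal_neBot_iff]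
  refine Set.infinite_of_injective_forall_mem
    (f := fun k : ℕ => (Pi.single (Fin.last n) ((k : ℤ) + 1) : Fin (n + 1) → ℤ)) ?_ fun k => ?_
  · intro k l h
    have := congrFun h (Fin.last n)
    simpa using this
  · simp only [mem_ofPred_eq, Pi.single_eq_same]
    omega

instance lower_neBot (n : ℕ) : (lower n).NeBot := by
  rw [lower, cofinite_inf_principal_neBot_iff]
  refine Set.infinite_of_injective_forall_mem
    (f := fun k : ℕ => (Pi.single (Fin.last n) (-(k : ℤ)) : Fin (n + 1) → ℤ)) ?_ fun k => ?_
  · intro k l h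
    have := congrFun h (Fin.last n)
    simpa using this
  · simp only [mem_ofPred_eq, Pi.single_eq_same]
    omega

end SlowOsc

/-! ### The waveguide operator. -/

section Main

variable {n : ℕ} {h₁ h₂ : ℝ} {Φm Φ0 Φp : ℓ^∞(Fin (n + 1) → ℤ, ℝ)}

theorem layeredConst_apply {G : Type*} (h₁ h₂ : ℝ) (π : G → ℤ) (cm c0 cp : ℝ) (x : G) :
    layeredConst G h₁ h₂ π cm c0 cp x = (Ioi h₂).indicator 1 (π x : ℝ) * cp
      + (Icc h₁ h₂).indicator 1 (π x : ℝ) * c0 + (Iio h₁).indicator 1 (π x : ℝ) * cm := by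
  rw [layeredConst, layered_apply]
  have hc : ∀ c : ℝ, (c • 1 : ℓ^∞(G, ℝ)) x = c := fun c => mul_one c
  rw [hc, hc, hc]

theorem abs_layered_sub_layeredConst_le {G : Type*} (hh : h₁ < h₂) {π : G → ℤ}
    {am a0 ap : ℓ^∞(G, ℝ)} {cm c0 cp : ℝ} {x : G} {δ : ℝ} (hm : |am x - cm| ≤ δ)
    (h0 : |a0 x - c0| ≤ δ) (hp : |ap x - cp| ≤ δ) :
    |layered h₁ h₂ π am a0 ap x - layeredConst G h₁ h₂ π cm c0 cp x| ≤ δ := by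
  rcases lt_or_ge (π x : ℝ) h₁ with h | h
  · rwa [layered_of_gt hh h, layeredConst_of_gt hh h]
  rcases lt_or_ge h₂ (π x : ℝ) with h' | h'
  · rwa [layered_of_lt hh h', layeredConst_of_lt hh h']
  · have e1 : ¬ (π x : ℝ) < h₁ := not_lt.2 h
    have e2 : ¬ h₂ < (π x : ℝ) := not_lt.2 h'
    rw [layered_apply, layeredConst_apply]
    simpa [Set.indicator, e1, e2, h, h'] using h0

theorem Lam.tendsto_seq (g : Lam Φm Φ0 Φp) : Tendsto g.seq atTop cofinite :=
  Tendsto.of_tendsto_comp (g := fun (x : Fin (n + 1) → ℤ) (i : Fin n) => x i.castSucc)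
    g.tendsto_init (comap_cofinite_le _)

theorem Lam.isLimitOperator (g : Lam Φm Φ0 Φp) (h₁ h₂ : ℝ) (hΦm : SlowlyOscillating Φm)
    (hΦ0 : SlowlyOscillating Φ0) (hΦp : SlowlyOscillating Φp) :
    IsLimitOperator (Waveguide.hamiltonian h₁ h₂ Φm Φ0 Φp) g.seq (g.hamiltonian h₁ h₂) := by
  refine isLimitOperator_schr _ g.tendsto_seq fun x => ?_
  simp only [layered_apply, layeredConst_apply, Pi.add_apply, g.seq_last]
  exact (((hΦp.tendsto_add g.tendsto_seq g.tendsto_pos x).const_mul _).add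
    ((hΦ0.tendsto_add g.tendsto_seq g.tendsto_zero x).const_mul _)).add
    ((hΦm.tendsto_add g.tendsto_seq g.tendsto_neg x).const_mul _)

theorem Lam.exists_layeredConst_eq (g : Lam Φm Φ0 Φp) (hh : h₁ < h₂) : ∃ K : ℤ, 0 ≤ K ∧
    (∀ t, K < t → layeredConst ℤ h₁ h₂ (fun t => t + g.height) g.cm g.c0 g.cp t = g.cp) ∧
    (∀ t, t < -K → layeredConst ℤ h₁ h₂ (fun t => t + g.height) g.cm g.c0 g.cp t = g.cm) := by
  refine ⟨max 0 (max (⌈h₂⌉ - g.height) (g.height - ⌊h₁⌋)), le_max_left _ _, fun t ht => ?_,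
    fun t ht => ?_⟩
  · refine layeredConst_of_lt hh (lt_of_le_of_lt (Int.le_ceil h₂) ?_)
    have : ⌈h₂⌉ < t + g.height := by omega
    exact_mod_cast this
  · refine layeredConst_of_gt hh (lt_of_lt_of_le ?_ (Int.floor_le h₁))
    have : t + g.height < ⌊h₁⌋ := by omega
    exact_mod_cast this

/-- A fixed vertical translation moves `g` to either side of the hyperplane and, by slow
oscillation, keeps the limit. Hence both limits obey the half space bounds whatever the height of
`g`. -/
theorem Lam.mem_Icc_of_tendsto (g : Lam Φm Φ0 Φp) {Φ : ℓ^∞(Fin (n + 1) → ℤ, ℝ)}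
    (hΦ : SlowlyOscillating Φ) {c : ℝ} (hc : Tendsto (fun j => Φ (g.seq j)) atTop (𝓝 c))
    {Q : ℤ → Prop} {s : ℤ} (hs : Q (s + g.height)) :
    c ∈ Icc (liminf Φ (cofinite ⊓ 𝓟 {x | Q (x (Fin.last n))}))
      (limsup Φ (cofinite ⊓ 𝓟 {x | Q (x (Fin.last n))})) := by
  refine mem_Icc_liminf_limsup Φ (h := fun j => Pi.single (Fin.last n) s + g.seq j) ?_
    (hΦ.tendsto_add g.tendsto_seq hc _)
  refine tendsto_inf.2 ⟨(add_right_injective _).tendsto_cofinite.comp g.tendsto_seq,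
    tendsto_principal.2 (Eventually.of_forall fun j => ?_)⟩
  simpa [g.seq_last] using hs

theorem Lam.cp_mem_Icc (g : Lam Φm Φ0 Φp) (hΦp : SlowlyOscillating Φp) :
    g.cp ∈ Icc (liminf Φp (upper n)) (limsup Φp (upper n)) :=
  g.mem_Icc_of_tendsto hΦp g.tendsto_pos (Q := fun t => 0 < t) (s := 1 - g.height) (by simp)

theorem Lam.cm_mem_Icc (g : Lam Φm Φ0 Φp) (hΦm : SlowlyOscillating Φm) :
    g.cm ∈ Icc (liminf Φm (lower n)) (limsup Φm (lower n)) :=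
  g.mem_Icc_of_tendsto hΦm g.tendsto_neg (Q := fun t => t ≤ 0) (s := - g.height) (by simp)

theorem norm_schr_sub_le_of_potential {G ι : Type*} [AddCommGroup G] [Fintype ι] (E : ι → G)
    {Φ Ψ : ℓ^∞(G, ℝ)} {δ : ℝ} (hδ : 0 ≤ δ) {v : ℓ^2(G, ℂ)} (h : ∀ x, v x ≠ 0 → |Φ x - Ψ x| ≤ δ)
    (z : ℂ) : ‖(schr E Ψ - z • ContinuousLinearMap.id ℂ ℓ^2(G, ℂ)) v‖
      ≤ ‖(schr E Φ - z • ContinuousLinearMap.id ℂ ℓ^2(G, ℂ)) v‖ + δ * ‖v‖ := by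
  have h1 : ‖(schr E Φ - z • ContinuousLinearMap.id ℂ ℓ^2(G, ℂ)) v
      - (schr E Ψ - z • ContinuousLinearMap.id ℂ ℓ^2(G, ℂ)) v‖ ≤ δ * ‖v‖ := by
    refine norm_le_of_forall_le hδ fun x => ?_
    simp only [sub_smul_id_apply, sub_eval, smul_eval, schr_apply]
    rw [sub_sub_sub_cancel_right, add_sub_add_left_eq_sub, ← sub_mul, norm_mul,
      ← Complex.ofReal_sub, Complex.norm_real, Real.norm_eq_abs]
    by_cases hx : v x = 0
    · simp [hx]
    · gcongr
      exact h x hx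
  have h2 := norm_le_norm_add_norm_sub ((schr E Φ - z • ContinuousLinearMap.id ℂ ℓ^2(G, ℂ)) v)
    ((schr E Ψ - z • ContinuousLinearMap.id ℂ ℓ^2(G, ℂ)) v)
  linarith

/-- An approximate eigenvector on whose support the potential is almost constant. -/
theorem mem_Icc_of_norm_le {G ι : Type*} [AddCommGroup G] [Fintype ι] (E : ι → G)
    {Φ : ℓ^∞(G, ℝ)} {c z ε δ : ℝ} (hδ : 0 ≤ δ) {v : ℓ^2(G, ℂ)} (hv : v ≠ 0)
    (h : ∀ x, v x ≠ 0 → |Φ x - c| ≤ δ)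
    (hle : ‖(schr E Φ - (z : ℂ) • ContinuousLinearMap.id ℂ ℓ^2(G, ℂ)) v‖ ≤ ε * ‖v‖) :
    z ∈ Icc (c - (ε + δ)) (c + 4 * Fintype.card ι + (ε + δ)) := by
  have hc : ∀ x, (c • 1 : ℓ^∞(G, ℝ)) x = c := fun x => mul_one c
  have h1 := norm_schr_sub_le_of_potential E (Φ := Φ) (Ψ := c • 1) hδ (v := v)
    (fun x hx => by rw [hc]; exact h x hx) z
  have h2 := le_norm_schr_of_const E (Φ := c • 1) (μ := z) (u := v) (fun x _ => hc x) le_rfl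
  have h3 : |z - c - 2 * Fintype.card ι| - 2 * Fintype.card ι ≤ ε + δ := by
    refine le_of_mul_le_mul_right ?_ (norm_pos_iff.2 hv)
    rw [add_mul]
    linarith
  have h4 := abs_le.1 (sub_le_iff_le_add.1 h3)
  constructor <;> linarith [h4.1, h4.2]

theorem eventually_forall_add {G : Type*} [AddCommGroup G] {q : G → Prop}
    (hq : ∀ᶠ x in cofinite, q x) (F : Finset G) : ∀ᶠ y in cofinite, ∀ w ∈ F, q (y + w) := by
  rw [Finset.eventually_all]
  exact fun w _ => (add_left_injective w).tendsto_cofinite.eventually hq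

/-- The trichotomy for localized approximate eigenvectors of the waveguide operator: they live in
the upper layer, in the lower layer, or near a point of the hyperplane `x_N = 0`. -/
theorem trichotomy_of_mem_essSpectrum (hh : h₁ < h₂) (hΦm : SlowlyOscillating Φm)
    (hΦ0 : SlowlyOscillating Φ0) (hΦp : SlowlyOscillating Φp) {z : ℝ}
    (hz : (z : ℂ) ∈ essSpectrum (Waveguide.hamiltonian h₁ h₂ Φm Φ0 Φp)) {ε : ℝ} (hε : 0 < ε)
    {S : Set (Fin (n + 1) → ℤ)} (hS : S.Finite) :
    z ∈ Icc (liminf Φp (upper n) - 4 * ε) (limsup Φp (upper n) + 4 * (n + 1) + 4 * ε) ∨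
    z ∈ Icc (liminf Φm (lower n) - 4 * ε) (limsup Φm (lower n) + 4 * (n + 1) + 4 * ε) ∨
    ∃ h ∉ S, h (Fin.last n) = 0 ∧ ∃ v : ℓ^2(Fin (n + 1) → ℤ, ℂ), v ≠ 0 ∧
      ‖(schr (fun j : Fin (n + 1) => Pi.single j (1 : ℤ))
        (layeredConst _ h₁ h₂ (fun x => x (Fin.last n)) (Φm h) (Φ0 h) (Φp h))
        - (z : ℂ) • ContinuousLinearMap.id ℂ ℓ^2(Fin (n + 1) → ℤ, ℂ)) v‖ ≤ 2 * ε * ‖v‖ := by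
  classical
  obtain ⟨F, hF⟩ := exists_localized_approx_eigenvector (isFolner_single (n + 1)) hz hε
  obtain ⟨C1, hC1⟩ := exists_nat_ge (max |h₁| |h₂|)
  obtain ⟨C0, hC0⟩ : ∃ C0 : ℤ, ∀ w ∈ F, |w (Fin.last n)| ≤ C0 := by
    obtain ⟨C0, hC0⟩ := (F.finite_toSet.image fun w => |w (Fin.last n)|).bddAbove
    exact ⟨C0, fun w hw => hC0 (mem_image_of_mem _ hw)⟩
  set C := C0 + C1 with hC
  set W := Finset.image₂ (fun (t : ℤ) w => Pi.single (Fin.last n) t + w) (Finset.Icc (-C) C) F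
    with hW
  have hosc : ∀ Φ : ℓ^∞(Fin (n + 1) → ℤ, ℝ), SlowlyOscillating Φ → ∀ A : Finset _,
      ∀ᶠ y in cofinite, ∀ w ∈ A, |Φ (y + w) - Φ y| < ε := fun Φ hΦ A => by
    rw [Finset.eventually_all]
    exact fun w _ => hΦ.eventually_abs_lt w hε
  have e1 : ∀ᶠ y in cofinite, ∀ w ∈ F, 0 < (y + w) (Fin.last n) →
      liminf Φp (upper n) - ε < Φp (y + w) ∧ Φp (y + w) < limsup Φp (upper n) + ε :=
    eventually_forall_add (q := fun x => 0 < x (Fin.last n) → liminf Φp (upper n) - ε < Φp x ∧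
      Φp x < limsup Φp (upper n) + ε)
      (eventually_inf_principal.1 (show ∀ᶠ x in cofinite ⊓ 𝓟 {x : Fin (n + 1) → ℤ | 0 < x (Fin.last n)}, _ from
        eventually_liminf_limsup Φp (upper n) hε)) F
  have e2 : ∀ᶠ y in cofinite, ∀ w ∈ F, (y + w) (Fin.last n) ≤ 0 →
      liminf Φm (lower n) - ε < Φm (y + w) ∧ Φm (y + w) < limsup Φm (lower n) + ε :=
    eventually_forall_add (q := fun x => x (Fin.last n) ≤ 0 → liminf Φm (lower n) - ε < Φm x ∧
      Φm x < limsup Φm (lower n) + ε)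
      (eventually_inf_principal.1 (show ∀ᶠ x in cofinite ⊓ 𝓟 {x : Fin (n + 1) → ℤ | x (Fin.last n) ≤ 0}, _ from
        eventually_liminf_limsup Φm (lower n) hε)) F
  -- The layered comparison is based at the projection of `y` to `x_N = 0`. The height of `y` is not
  -- yet known, so every height up to `C` is controlled at once.
  have e3 : ∀ᶠ y in cofinite, ∀ t ∈ (Finset.Icc (-C) C).image fun t : ℤ =>
      (-Pi.single (Fin.last n) t : Fin (n + 1) → ℤ), (y + t ∉ S ∧
        (∀ w ∈ W, |Φm (y + t + w) - Φm (y + t)| < ε) ∧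
        (∀ w ∈ W, |Φ0 (y + t + w) - Φ0 (y + t)| < ε) ∧
        (∀ w ∈ W, |Φp (y + t + w) - Φp (y + t)| < ε)) :=
    eventually_forall_add (hS.eventually_cofinite_notMem.and
      ((hosc Φm hΦm W).and ((hosc Φ0 hΦ0 W).and (hosc Φp hΦp W)))) _
  have hall := e1.and (e2.and (e3.and ((hosc Φp hΦp F).and (hosc Φm hΦm F))))
  obtain ⟨y, hy, v, hv, hsupp, hle⟩ := hF _ (eventually_cofinite.1 hall)
  simp only [mem_ofPred_eq, not_not] at hy
  obtain ⟨hy1, hy2, hy3, hyp, hym⟩ := hy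
  obtain ⟨x₀, hx₀⟩ : ∃ x, v x ≠ 0 := by
    by_contra! hcon
    exact hv (by ext x; exact hcon x)
  have hyx : ∀ x, y + (x - y) = x := fun x => by abel
  by_cases hup : ∀ x, v x ≠ 0 → 0 < x (Fin.last n) ∧ h₂ < x (Fin.last n)
  · refine Or.inl ?_
    have h1 := hy1 _ (hsupp x₀ hx₀)
    rw [hyx] at h1
    have h2 := h1 (hup x₀ hx₀).1
    -- The total error `4ε` is `ε` for the residual, `2ε` for comparing two support points through
    -- `y`, and `ε` for the liminf and limsup bounds.
    have h3 := mem_Icc_of_norm_le _ (c := Φp x₀) (δ := 2 * ε) (by positivity) hv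
      (fun x hx => ?_) hle
    · rw [Fintype.card_fin] at h3
      push_cast at h3
      exact ⟨by linarith [h3.1], by linarith [h3.2]⟩
    · rw [layered_of_lt (π := fun x : Fin (n + 1) → ℤ => x (Fin.last n)) (x := x) hh (hup x hx).2]
      have h3 := abs_lt.1 (hyp _ (hsupp x hx))
      have h4 := abs_lt.1 (hyp _ (hsupp x₀ hx₀))
      rw [hyx] at h3 h4
      exact abs_le.2 ⟨by linarith, by linarith⟩
  by_cases hlow : ∀ x, v x ≠ 0 → x (Fin.last n) ≤ 0 ∧ x (Fin.last n) < h₁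
  · refine Or.inr (Or.inl ?_)
    have h1 := hy2 _ (hsupp x₀ hx₀)
    rw [hyx] at h1
    have h2 := h1 (hlow x₀ hx₀).1
    have h3 := mem_Icc_of_norm_le _ (c := Φm x₀) (δ := 2 * ε) (by positivity) hv
      (fun x hx => ?_) hle
    · rw [Fintype.card_fin] at h3
      push_cast at h3
      exact ⟨by linarith [h3.1], by linarith [h3.2]⟩
    · rw [layered_of_gt (π := fun x : Fin (n + 1) → ℤ => x (Fin.last n)) (x := x) hh (hlow x hx).2]
      have h3 := abs_lt.1 (hym _ (hsupp x hx))
      have h4 := abs_lt.1 (hym _ (hsupp x₀ hx₀))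
      rw [hyx] at h3 h4
      exact abs_le.2 ⟨by linarith, by linarith⟩
  -- Some support point has height at most `C1` and some has height at least `-C1`. Since the
  -- support is `y` plus a bounded shape, the height of `y` is at most `C` in absolute value.
  · refine Or.inr (Or.inr ?_)
    push Not at hup hlow
    obtain ⟨x, hx, hx'⟩ := hup
    obtain ⟨x', hx1, hx1'⟩ := hlow
    have hb1 : x (Fin.last n) ≤ C1 := by
      by_contra! hcon
      have h1 : (C1 : ℝ) < x (Fin.last n) := by exact_mod_cast hcon
      have h2 := hx' (by omega)
      linarith [le_max_right |h₁| |h₂|, le_abs_self h₂]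
    have hb2 : -(C1 : ℤ) ≤ x' (Fin.last n) := by
      by_contra! hcon
      have h1 : (x' (Fin.last n) : ℝ) < -C1 := by exact_mod_cast hcon
      have h2 := hx1' (by omega)
      linarith [le_max_left |h₁| |h₂|, neg_abs_le h₁]
    have hb3 := abs_le.1 (hC0 _ (hsupp x hx))
    have hb4 := abs_le.1 (hC0 _ (hsupp x' hx1))
    rw [Pi.sub_apply] at hb3 hb4
    have hyC : y (Fin.last n) ∈ Finset.Icc (-C) C := by
      rw [Finset.mem_Icc]
      omega
    obtain ⟨hhS, hosm, hos0, hosp⟩ := hy3 _ (Finset.mem_image_of_mem _ hyC)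
    set h := y + -Pi.single (Fin.last n) (y (Fin.last n)) with hh'
    refine ⟨h, hhS, by simp [hh'], v, hv, ?_⟩
    have hmem : ∀ x, v x ≠ 0 → x - h ∈ W := fun x hx =>
      Finset.mem_image₂.2 ⟨_, hyC, _, hsupp x hx, by rw [hh']; abel⟩
    have hhx : ∀ x, h + (x - h) = x := fun x => by abel
    refine (norm_schr_sub_le_of_potential _
      (Φ := layered h₁ h₂ (fun x => x (Fin.last n)) Φm Φ0 Φp) hε.le (fun x hx => ?_) z).trans ?_
    · have h1 := (hosm _ (hmem x hx)).le
      have h2 := (hos0 _ (hmem x hx)).le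
      have h3 := (hosp _ (hmem x hx)).le
      rw [hhx] at h1 h2 h3
      exact abs_layered_sub_layeredConst_le hh h1 h2 h3
    · rw [two_mul, add_mul]
      exact add_le_add hle le_rfl

/-- The k-th point avoids the first k points of an enumeration of `G`. -/
theorem exists_seq_tendsto_cofinite {G : Type*} [Countable G] [Nonempty G] {p : ℕ → G → Prop}
    (hp : ∀ k, ∀ S : Set G, S.Finite → ∃ x ∉ S, p k x) :
    ∃ h : ℕ → G, Tendsto h atTop cofinite ∧ ∀ k, p k (h k) := by
  obtain ⟨e, he⟩ := exists_surjective_nat G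
  choose h hS hp using fun k => hp k (e '' Iio k) ((finite_Iio k).image e)
  refine ⟨h, hasBasis_cofinite.tendsto_right_iff.2 fun S hSf => ?_, hp⟩
  have h1 : ∀ᶠ k in atTop, ∀ x ∈ S, h k ≠ x := by
    rw [eventually_all_finite hSf]
    intro x _
    obtain ⟨i, rfl⟩ := he x
    filter_upwards [eventually_gt_atTop i] with k hk hki
    exact hS k (hki ▸ mem_image_of_mem e hk)
  filter_upwards [h1] with k hk hkS
  exact hk _ hkS rfl

theorem tendsto_init_of_last_eq_zero {h : ℕ → Fin (n + 1) → ℤ} (hh : Tendsto h atTop cofinite)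
    (h0 : ∀ k, h k (Fin.last n) = 0) :
    Tendsto (fun k => fun i : Fin n => h k i.castSucc) atTop cofinite := by
  refine hasBasis_cofinite.tendsto_right_iff.2 fun S hS => ?_
  have h1 := hh.eventually (hS.image fun y =>
    (Fin.snoc (α := fun _ => ℤ) y 0 : Fin (n + 1) → ℤ)).eventually_cofinite_notMem
  filter_upwards [h1] with k hk hkS
  refine hk ⟨_, hkS, ?_⟩
  ext i
  refine Fin.lastCases ?_ (fun j => ?_) i
  · simp [h0]
  · simp

/-- If approximate eigenvectors live near the hyperplane `x_N = 0`, then `z` belongs to the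
spectrum of a limit operator. -/
theorem exists_lam_of_approx (hh : h₁ < h₂) {z : ℝ}
    (H : ∀ ε > 0, ∀ S : Set (Fin (n + 1) → ℤ), S.Finite →
      ∃ h ∉ S, h (Fin.last n) = 0 ∧ ∃ v : ℓ^2(Fin (n + 1) → ℤ, ℂ), v ≠ 0 ∧
        ‖(schr (fun j : Fin (n + 1) => Pi.single j (1 : ℤ))
          (layeredConst _ h₁ h₂ (fun x => x (Fin.last n)) (Φm h) (Φ0 h) (Φp h))
          - (z : ℂ) • ContinuousLinearMap.id ℂ ℓ^2(Fin (n + 1) → ℤ, ℂ)) v‖ ≤ ε * ‖v‖) :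
    ∃ g : Lam Φm Φ0 Φp, ∃ x : ℝ, (x : ℂ) ∈ spectrum ℂ (g.jacobi h₁ h₂) ∧
      x ∈ Icc (z - 4 * n) z := by
  obtain ⟨h, hcof, hp⟩ := exists_seq_tendsto_cofinite
    (fun k : ℕ => H (1 / ((k : ℝ) + 1)) (by positivity))
  choose h0 v hv hle using hp
  -- Bolzano–Weierstrass for the bounded triples of potential values yields the limits demanded of
  -- an element of `Λ`.
  obtain ⟨⟨a, b, c⟩, -, φ, hφ, hlim⟩ := tendsto_subseq_of_bounded
    (Metric.isBounded_closedBall (x := (0 : ℝ × ℝ × ℝ)) (r := max ‖Φm‖ (max ‖Φ0‖ ‖Φp‖)))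
    (x := fun k => (Φm (h k), Φ0 (h k), Φp (h k))) (fun k => by
      rw [mem_closedBall_zero_iff, Prod.norm_mk, Prod.norm_mk]
      exact max_le_max (lp.norm_apply_le_norm (by simp) _ _)
        (max_le_max (lp.norm_apply_le_norm (by simp) _ _) (lp.norm_apply_le_norm (by simp) _ _)))
  have ha : Tendsto (fun k => Φm (h (φ k))) atTop (𝓝 a) := (continuous_fst.tendsto _).comp hlim
  have hb : Tendsto (fun k => Φ0 (h (φ k))) atTop (𝓝 b) :=
    ((continuous_fst.comp continuous_snd).tendsto _).comp hlim
  have hc : Tendsto (fun k => Φp (h (φ k))) atTop (𝓝 c) :=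
    ((continuous_snd.comp continuous_snd).tendsto _).comp hlim
  let g : Lam Φm Φ0 Φp :=
    { seq := fun k => h (φ k)
      height := 0
      tendsto_init := tendsto_init_of_last_eq_zero (hcof.comp hφ.tendsto_atTop) fun k => h0 _
      seq_last := fun k => h0 _
      cm := a
      c0 := b
      cp := c
      tendsto_neg := ha
      tendsto_zero := hb
      tendsto_pos := hc }
  refine ⟨g, ?_⟩
  by_contra! hcon
  obtain ⟨η, hη, hbd⟩ := exists_le_norm_schr_of_spectrum_jacobi (n := n)
    (Φ := layeredConst _ h₁ h₂ (fun x => x (Fin.last n)) a b c)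
    (φ := layeredConst ℤ h₁ h₂ (fun t => t + 0) a b c)
    (fun x => by rw [layeredConst_apply, layeredConst_apply, add_zero]) (z := z) hcon
  have hδ : Tendsto (fun k => |Φm (h (φ k)) - a| + |Φ0 (h (φ k)) - b| + |Φp (h (φ k)) - c|
      + 1 / ((φ k : ℝ) + 1)) atTop (𝓝 0) := by
    have h1 := (((ha.sub_const a).abs.add (hb.sub_const b).abs).add (hc.sub_const c).abs).add
      ((tendsto_one_div_add_atTop_nhds_zero_nat (𝕜 := ℝ)).comp hφ.tendsto_atTop)
    simpa using h1
  -- For this `k` the residual plus the change of potential is below the lower bound `η` of the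
  -- limit operator, which is impossible.
  obtain ⟨k, hk⟩ := (hδ.eventually (gt_mem_nhds hη)).exists
  set δ := |Φm (h (φ k)) - a| + |Φ0 (h (φ k)) - b| + |Φp (h (φ k)) - c| with hδdef
  have h1 := norm_schr_sub_le_of_potential (fun j : Fin (n + 1) => Pi.single j (1 : ℤ))
    (Φ := layeredConst _ h₁ h₂ (fun x => x (Fin.last n)) (Φm (h (φ k))) (Φ0 (h (φ k)))
      (Φp (h (φ k))))
    (Ψ := layeredConst _ h₁ h₂ (fun x => x (Fin.last n)) a b c) (δ := δ) (by positivity)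
    (v := v (φ k)) (fun x _ => by
      have hm : |Φm (h (φ k)) - a| ≤ δ := by
        linarith [abs_nonneg (Φ0 (h (φ k)) - b), abs_nonneg (Φp (h (φ k)) - c)]
      have h0 : |Φ0 (h (φ k)) - b| ≤ δ := by
        linarith [abs_nonneg (Φm (h (φ k)) - a), abs_nonneg (Φp (h (φ k)) - c)]
      have hp : |Φp (h (φ k)) - c| ≤ δ := by
        linarith [abs_nonneg (Φm (h (φ k)) - a), abs_nonneg (Φ0 (h (φ k)) - b)]
      have hc : ∀ r : ℝ, (r • 1 : ℓ^∞(Fin (n + 1) → ℤ, ℝ)) x = r := fun r => mul_one r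
      refine abs_layered_sub_layeredConst_le hh ?_ ?_ ?_ <;> rwa [hc]) z
  have h2 := hbd (v (φ k))
  have h3 := hle (φ k)
  have h4 := norm_pos_iff.2 (hv (φ k))
  nlinarith

/-- Outside the two outer intervals only the third case of the trichotomy survives, for all small
`ε`, giving `x` in the spectrum of some `L^g` with `x ≤ z ≤ x + 4n`. If `x` lay in a band `[c, c +
4]`, then `z` would lie in `[c, c + 4(n + 1)]`, inside an outer interval; so `x` is a discrete
eigenvalue. -/
theorem essSpectrum_hamiltonian_subset (hh : h₁ < h₂) (hΦm : SlowlyOscillating Φm)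
    (hΦ0 : SlowlyOscillating Φ0) (hΦp : SlowlyOscillating Φp) {z : ℝ}
    (hz : (z : ℂ) ∈ essSpectrum (Waveguide.hamiltonian h₁ h₂ Φm Φ0 Φp)) :
    z ∈ Icc (liminf Φm (lower n)) (limsup Φm (lower n) + 4 * (n + 1)) ∨
    z ∈ Icc (liminf Φp (upper n)) (limsup Φp (upper n) + 4 * (n + 1)) ∨
    ∃ g : Lam Φm Φ0 Φp, ∃ lam : ℝ, (lam : ℂ) ∈ discreteSpectrum (g.jacobi h₁ h₂) ∧
      z ∈ Icc lam (lam + 4 * n) := by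
  by_contra! hcon
  obtain ⟨hm, hp, hg⟩ := hcon
  have hpos : ∀ a b : ℝ, z ∉ Icc a b → ∃ ε₀ > 0, ∀ ε ≤ ε₀, z ∉ Icc (a - 4 * ε) (b + 4 * ε) := by
    intro a b hab
    rw [mem_Icc, not_and_or, not_le, not_le] at hab
    rcases hab with h | h
    · exact ⟨(a - z) / 8, by linarith, fun ε hε hz => by linarith [hz.1]⟩
    · exact ⟨(z - b) / 8, by linarith, fun ε hε hz => by linarith [hz.2]⟩
  obtain ⟨ε₁, hε₁, h1⟩ := hpos _ _ hm
  obtain ⟨ε₂, hε₂, h2⟩ := hpos _ _ hp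
  obtain ⟨g, x, hx, hxz⟩ := exists_lam_of_approx (Φm := Φm) (Φ0 := Φ0) (Φp := Φp) hh (z := z)
    fun ε hε S hS => by
      have hδ : 0 < min (ε / 2) (min ε₁ ε₂) := by positivity
      have hδ1 : min (ε / 2) (min ε₁ ε₂) ≤ ε₁ := (min_le_right _ _).trans (min_le_left _ _)
      have hδ2 : min (ε / 2) (min ε₁ ε₂) ≤ ε₂ := (min_le_right _ _).trans (min_le_right _ _)
      have hδ3 : min (ε / 2) (min ε₁ ε₂) ≤ ε / 2 := min_le_left _ _
      rcases trichotomy_of_mem_essSpectrum hh hΦm hΦ0 hΦp hz hδ hS with h | h | h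
      · exact absurd h (h2 _ hδ2)
      · exact absurd h (h1 _ hδ1)
      · obtain ⟨y, hyS, hy0, v, hv, hle⟩ := h
        refine ⟨y, hyS, hy0, v, hv, hle.trans ?_⟩
        gcongr
        linarith
  obtain ⟨K, hK, hKp, hKm⟩ := g.exists_layeredConst_eq hh
  have hsp := spectrum_eq_essSpectrum_union (isSelfAdjoint_jacobi
    (layeredConst ℤ h₁ h₂ (fun t => t + g.height) g.cm g.c0 g.cp))
  rw [Lam.jacobi, hsp] at hx
  rcases hx with hx | hx
  · rw [essSpectrum_jacobi hK hKp hKm] at hx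
    obtain ⟨x', hx', hxx⟩ := hx
    rw [Complex.ofReal_injective hxx] at hx'
    rcases hx' with hx' | hx'
    · have h3 := g.cp_mem_Icc hΦp
      exact hp ⟨by linarith [h3.1, hx'.1, hxz.2], by linarith [h3.2, hx'.2, hxz.1]⟩
    · have h3 := g.cm_mem_Icc hΦm
      exact hm ⟨by linarith [h3.1, hx'.1, hxz.2], by linarith [h3.2, hx'.2, hxz.1]⟩
  · exact hg g x hx ⟨hxz.2, by linarith [hxz.1]⟩

theorem mem_essSpectrum_hamiltonian_of_upper (hh : h₁ < h₂) (hΦp : SlowlyOscillating Φp) {z : ℝ}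
    (hz : z ∈ Icc (liminf Φp (upper n)) (limsup Φp (upper n) + 4 * (n + 1))) :
    (z : ℂ) ∈ essSpectrum (Waveguide.hamiltonian h₁ h₂ Φm Φ0 Φp) := by
  refine mem_essSpectrum_of_mem_Icc_liminf hΦp (Or.inl rfl) (F := upper n) inf_le_left ?_
    (K := ⌊h₂⌋ + 1) (fun x hx => layered_of_lt hh ?_) hz
  · exact mem_inf_of_right (mem_principal.2 fun x hx => by
      have : 0 < x (Fin.last n) := hx
      change 0 ≤ 1 * x (Fin.last n)
      omega)
  · refine lt_of_lt_of_le (Int.lt_floor_add_one h₂) ?_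
    rw [one_mul] at hx
    exact_mod_cast hx

theorem mem_essSpectrum_hamiltonian_of_lower (hh : h₁ < h₂) (hΦm : SlowlyOscillating Φm) {z : ℝ}
    (hz : z ∈ Icc (liminf Φm (lower n)) (limsup Φm (lower n) + 4 * (n + 1))) :
    (z : ℂ) ∈ essSpectrum (Waveguide.hamiltonian h₁ h₂ Φm Φ0 Φp) := by
  refine mem_essSpectrum_of_mem_Icc_liminf hΦm (Or.inr rfl) (F := lower n) inf_le_left ?_
    (K := 1 - ⌈h₁⌉) (fun x hx => layered_of_gt hh ?_) hz
  · exact mem_inf_of_right (mem_principal.2 fun x hx => by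
      have : x (Fin.last n) ≤ 0 := hx
      change 0 ≤ -1 * x (Fin.last n)
      omega)
  · have h1 : x (Fin.last n) < ⌈h₁⌉ := by omega
    exact Int.lt_ceil.1 h1

theorem Lam.mem_essSpectrum_hamiltonian (g : Lam Φm Φ0 Φp) (hΦm : SlowlyOscillating Φm)
    (hΦ0 : SlowlyOscillating Φ0) (hΦp : SlowlyOscillating Φp) {lam z : ℝ}
    (hlam : (lam : ℂ) ∈ discreteSpectrum (g.jacobi h₁ h₂)) (hz : z ∈ Icc lam (lam + 4 * n)) :
    (z : ℂ) ∈ essSpectrum (Waveguide.hamiltonian h₁ h₂ Φm Φ0 Φp) := by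
  refine mem_essSpectrum_of_isLimitOperator fun ε hε =>
    ⟨g.seq, g.hamiltonian h₁ h₂, g.isLimitOperator h₁ h₂ hΦm hΦ0 hΦp, ?_⟩
  have h1 := exists_approx_eigenvector_schr
    (Φ := layeredConst _ h₁ h₂ (fun x => x (Fin.last n) + g.height) g.cm g.c0 g.cp)
    (fun x => by rw [layeredConst_apply, layeredConst_apply]) hlam.1 (s := z - lam)
    ⟨by linarith [hz.1], by linarith [hz.2]⟩ hε
  rw [add_sub_cancel] at h1
  exact h1

theorem isSelfAdjoint_hamiltonian (h₁ h₂ : ℝ) (Φm Φ0 Φp : ℓ^∞(Fin (n + 1) → ℤ, ℝ)) :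
    IsSelfAdjoint (Waveguide.hamiltonian h₁ h₂ Φm Φ0 Φp) :=
  isSelfAdjoint_schr _ _

end Main

end

end Waveguide

theorem mainTheorem8 (n : ℕ) (h₁ h₂ : ℝ) (hh : h₁ < h₂)
    (Φm Φ0 Φp : ℓ^∞(Fin (n + 1) → ℤ, ℝ))
    (hΦm : Waveguide.SlowlyOscillating Φm) (hΦ0 : Waveguide.SlowlyOscillating Φ0)
    (hΦp : Waveguide.SlowlyOscillating Φp) :
    (∀ g : Waveguide.Lam Φm Φ0 Φp,
      Waveguide.IsLimitOperator (Waveguide.hamiltonian h₁ h₂ Φm Φ0 Φp) g.seq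
        (g.hamiltonian h₁ h₂) ∧
      Waveguide.essSpectrum (g.jacobi h₁ h₂) =
        Complex.ofReal '' (Icc g.cp (g.cp + 4) ∪ Icc g.cm (g.cm + 4)) ∧
      spectrum ℂ (g.jacobi h₁ h₂) =
        Waveguide.essSpectrum (g.jacobi h₁ h₂) ∪ Waveguide.discreteSpectrum (g.jacobi h₁ h₂) ∧
      (Waveguide.discreteSpectrum (g.jacobi h₁ h₂)).Finite ∧
      Disjoint (Waveguide.essSpectrum (g.jacobi h₁ h₂))
        (Waveguide.discreteSpectrum (g.jacobi h₁ h₂))) ∧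
    Waveguide.essSpectrum (Waveguide.hamiltonian h₁ h₂ Φm Φ0 Φp) =
      Complex.ofReal ''
        (Icc (liminf Φm (Waveguide.lower n)) (limsup Φm (Waveguide.lower n) + 4 * (n + 1)) ∪
         Icc (liminf Φp (Waveguide.upper n)) (limsup Φp (Waveguide.upper n) + 4 * (n + 1)) ∪
         ⋃ (g : Waveguide.Lam Φm Φ0 Φp)
           (lam ∈ {lam : ℝ | (lam : ℂ) ∈ Waveguide.discreteSpectrum (g.jacobi h₁ h₂)}),
           Icc lam (lam + 4 * n)) := by
  refine ⟨fun g => ?_, Subset.antisymm (fun z hz => ?_) ?_⟩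
  · obtain ⟨K, hK, hKp, hKm⟩ := g.exists_layeredConst_eq hh
    exact ⟨g.isLimitOperator h₁ h₂ hΦm hΦ0 hΦp, Waveguide.essSpectrum_jacobi hK hKp hKm,
      Waveguide.spectrum_eq_essSpectrum_union (Waveguide.isSelfAdjoint_jacobi _),
      Waveguide.finite_discreteSpectrum_jacobi hK hKp hKm,
      Waveguide.disjoint_essSpectrum_discreteSpectrum_jacobi hK hKp hKm⟩
  · have hr := Waveguide.spectrum_eq_ofReal_re
      (Waveguide.isSelfAdjoint_hamiltonian h₁ h₂ Φm Φ0 Φp)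
      (Waveguide.essSpectrum_subset_spectrum _ hz)
    rw [hr] at hz
    refine ⟨z.re, ?_, hr.symm⟩
    rcases Waveguide.essSpectrum_hamiltonian_subset hh hΦm hΦ0 hΦp hz with h | h | h
    · exact Or.inl (Or.inl h)
    · exact Or.inl (Or.inr h)
    · obtain ⟨g, lam, hlam, h⟩ := h
      exact Or.inr (mem_iUnion.2 ⟨g, mem_iUnion₂.2 ⟨lam, hlam, h⟩⟩)
  · rintro _ ⟨z, (hz | hz) | hz, rfl⟩
    · exact Waveguide.mem_essSpectrum_hamiltonian_of_lower hh hΦm hz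
    · exact Waveguide.mem_essSpectrum_hamiltonian_of_upper hh hΦp hz
    · obtain ⟨g, hz⟩ := mem_iUnion.1 hz
      obtain ⟨lam, hlam, hz⟩ := mem_iUnion₂.1 hz
      exact g.mem_essSpectrum_hamiltonian hΦm hΦ0 hΦp hlam hz
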